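/- **Conventions.** For $c\in\mathbb R$ put $A_c=\begin{pmatrix}c&-1\\1&0\end{pmatrix}$, and $A_\infty=I$; put $t^w=\begin{pmatrix}1&w\\0&1\end{pmatrix}$. For $|\kappa|=1$ let $\mu(\kappa)\in[0,1)$ be the number with $\kappa=e^{2\pi i\mu(\kappa)}$. Let $\Gamma\subseteq \mathrm{SL}_2(\mathbb R)$ be the preimage of a discrete subgroup of $\mathrm{PSL}_2(\mathbb R)$ and let $\rho:\Gamma\to\mathrm{GL}_m(\mathbb C)$ be a representation such that all eigenvalues of $\rho(\gamma)$ have modulus $1$ for every parabolic $\gamma\in\Gamma$, and $\rho(-I)=I$ (admissible or logarithmic). A *weakly holomorphic vvaf of weight $0$ for $(\Gamma,\rho)$* is a holomorphic $X:\mathbb H\to\mathbb C^m$ with $X(\gamma\tau)=\rho(\gamma)X(\tau)$ for all $\gamma\in\Gamma$ such that, for every cusp $c$ of $\Gamma$, $\|X(A_c\tau)\|$ grows at most like $e^{C\,\mathrm{Im}\,\tau}$ as $\mathrm{Im}\,\tau\to\infty$ on each vertical strip. If $\infty$ is a cusp of $\Gamma$ of width $w$ (the least $w>0$ with $t^w\in\Gamma$),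 put $T=\rho(t^w)$ and $q=e^{2\pi i\tau/w}$, $\log q=2\pi i\tau/w$, $q^x=e^{2\pi i x\tau/w}$. The Fourier coefficients $X[\kappa,j,n]\in\mathbb C^m$ of $X$ at $\infty$ are defined by $$X(\tau)=\sum_{\kappa}\ \sum_{0\le j<m(\kappa)}(\log q)^j\,q^{\mu(\kappa)}\sum_{n\ge -M}X[\kappa,j,n]\,q^n ,$$ where $\kappa$ runs through the distinct eigenvalues of $T$ and $m(\kappa)$ is the size of the largest Jordan block of $T$ for $\kappa$; coefficients outside the range of summation are $0$. Put $X[n]=\sum_\kappa X[\kappa,0,n]$. (If $T=Pe^{2\pi i\Lambda}P^{-1}$ with $\Lambda$ diagonal with entries in $[0,1)$, this says $X=Pq^{\Lambda}P^{-1}\sum_n X[n]q^n$.) **Theorem.** Let $G\subseteq \mathrm{PSL}_2(\mathbb R)$ be a Fuchsian group of the first kind, $H\subseteq G$ a subgroup of finite index $d$, and $G',H'$ their preimages in $\mathrm{SL}_2(\mathbb R)$. Let $\rho:H'\to \mathrm{GL}_m(\mathbb C)$ be a representation and $X$ a weakly holomorphic vvaf of weight $0$ for $(H',\rho)$. Let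 $g_1,\dots,g_d$ be any representatives of $G'/H'$. Let $\widetilde\rho$ be the induced representation of $G'$, with $(a,b)$ block $\rho(g_a^{-1}\gamma g_b)$ if $g_a^{-1}\gamma g_b\in H'$ and $0$ otherwise, and let $\widetilde X(\tau)=(X(g_a^{-1}\tau))_{1\le a\le d}$ be the lift of $X$. Let $c$ be a cusp of $G$. Then: 1. $\widetilde X$ is a weakly holomorphic vvaf of weight $0$ for $(G',\widetilde\rho)$. For $1\le a\le d$ put $s_a=A_c^{-1}g_a$. Then $X^{(a)}(\tau)=X(s_a^{-1}\tau)$ is a weakly holomorphic vvaf of weight $0$ for the conjugate $(s_aH's_a^{-1},\ s_a\gamma s_a^{-1}\mapsto\rho(\gamma))$. The $X^{(a)}$ have Fourier expansions at $\infty$ as above, and so does $\widetilde X(A_c\tau)$, as a form for $A_c^{-1}G'A_c$ and the representation $A_c^{-1}\gamma A_c\mapsto\widetilde\rho(\gamma)$. Let $X^{(a)}[\cdot]$ and $\widetilde X[\cdot]$ denote their coefficients, and $T_a$ and $\widetilde T$ the corresponding matrices $T$. 2. There are integers $h_a\ge 1$ such that the width of $\infty$ for $s_aH's_a^{-1}$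 is $h_a$ times its width for $A_c^{-1}G'A_c$, and for all $\kappa\in\mathbb C^\times$ with $|\kappa|=1$, all $j\ge 0$ and all $n\in\mathbb Z$, $$\widetilde X[\kappa,j,n]=\Bigl(h_a^{-j}\,X^{(a)}\bigl[\kappa^{h_a},\,j,\,h_an+\lfloor h_a\mu(\kappa)\rfloor\bigr]\Bigr)_{1\le a\le d}.$$ 3. There are also integers $0\le n_a<h_a$, matrices $R_a$ with $R_a^{h_a}=T_a$ all of whose eigenvalues $\kappa$ satisfy $\lfloor h_a\mu(\kappa)\rfloor=n_a$, and a matrix $P\in\mathrm{GL}_{dm}(\mathbb C)$ with $P^{-1}\widetilde TP=\mathrm{diag}(R_1,\dots,R_d)$, such that in the basis given by $P$, for all $n\in\mathbb Z$, $$P^{-1}\widetilde X[n]=\bigl(X^{(a)}[h_an+n_a]\bigr)_{1\le a\le d},$$ and, for all $\kappa,j,n$ as in 2, the $a$-th block of $P^{-1}\widetilde X[\kappa,j,n]$ is $h_a^{-j}\,X^{(a)}[\kappa^{h_a},j,h_an+n_a]$ if $\lfloor h_a\mu(\kappa)\rfloor=n_a$, and $0$ otherwise. -/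

import Mathlib

open UpperHalfPlane MeasureTheory
open scoped MatrixGroups

noncomputable section

namespace VVAF

/-! ### Fuchsian groups -/

/-- `PSL₂(ℝ) = SL₂(ℝ) / {± 1}`. -/
abbrev PSL2R : Type := Matrix.ProjectiveSpecialLinearGroup (Fin 2) ℝ

/-- The preimage `G'` in `SL₂(ℝ)` of a subgroup `G` of `PSL₂(ℝ)`. -/
def preimageSL (G : Subgroup PSL2R) : Subgroup SL(2, ℝ) :=
  G.comap (QuotientGroup.mk' (Subgroup.center SL(2, ℝ)))

/-- A subgroup of `SL₂(ℝ)`, regarded as a subgroup of `GL₂(ℝ)`. -/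
def toGL (Γ : Subgroup SL(2, ℝ)) : Subgroup (GL (Fin 2) ℝ) :=
  Γ.map (Matrix.SpecialLinearGroup.mapGL ℝ)

/-- `Γ` is the preimage in `SL₂(ℝ)` of a Fuchsian group of the first kind: it is discrete, and it
has a (strict, measurable) fundamental domain in `ℍ` of finite hyperbolic area. The measure on `ℍ`
is `dx dy / y ^ 2`. -/
structure IsFuchsianFirstKind (Γ : Subgroup SL(2, ℝ)) : Prop where
  discrete : DiscreteTopology Γ
  finite_area : ∃ F : Set ℍ, MeasurableSet F ∧ volume F < ⊤ ∧
    ∀ τ : ℍ, ∃! z : ℍ, z ∈ F ∧ ∃ γ ∈ Γ, γ • τ = z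

/-- The translation matrix `t ^ w`. -/
def transl (w : ℝ) : SL(2, ℝ) := ⟨!![1, w; 0, 1], by simp [Matrix.det_fin_two]⟩

/-- The matrix `A_c` with `A_c ∞ = c`: the identity for `c = ∞`, and `(c, -1; 1, 0)` for real `c`. -/
def scaling : OnePoint ℝ → SL(2, ℝ)
  | none => 1
  | some c => ⟨!![c, -1; 1, 0], by simp [Matrix.det_fin_two]⟩

/-- The cusp width of a cusp `c` of `Γ`: the smallest `w > 0` with `A_c t ^ w A_c⁻¹ ∈ Γ`. -/
def cuspWidth (Γ : Subgroup SL(2, ℝ)) (c : OnePoint ℝ) : ℝ :=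
  sInf {w : ℝ | 0 < w ∧ scaling c * transl w * (scaling c)⁻¹ ∈ Γ}

/-! ### Representations -/

section Rep

variable {ι : Type} [Fintype ι] [DecidableEq ι] {Γ : Subgroup SL(2, ℝ)}

/-- The matrix `ρ γ` for `γ ∈ Γ`, extended by zero to the whole of `SL₂(ℝ)`. -/
def repMat (ρ : Γ →* GL ι ℂ) (γ : SL(2, ℝ)) : Matrix ι ι ℂ :=
  open Classical in if h : γ ∈ Γ then (ρ ⟨γ, h⟩ : Matrix ι ι ℂ) else 0

/-- The set of eigenvalues of a complex matrix. -/
def eigs (T : Matrix ι ι ℂ) : Finset ℂ := T.charpoly.roots.toFinset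

/-- All eigenvalues of `ρ γ` have modulus one, for every parabolic `γ ∈ Γ`. -/
def HasUnitaryCuspEigenvalues (ρ : Γ →* GL ι ℂ) : Prop :=
  ∀ γ ∈ Γ, Matrix.IsParabolic (γ : Matrix (Fin 2) (Fin 2) ℝ) → ∀ κ ∈ eigs (repMat ρ γ), ‖κ‖ = 1

/-- The conjugate group `s Γ s⁻¹`. -/
abbrev conjSubgroup (s : SL(2, ℝ)) (Γ : Subgroup SL(2, ℝ)) : Subgroup SL(2, ℝ) :=
  Γ.map ((MulAut.conj s : SL(2, ℝ) ≃* SL(2, ℝ)) : SL(2, ℝ) →* SL(2, ℝ))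

/-- The conjugate representation `s γ s⁻¹ ↦ ρ γ` of `s Γ s⁻¹`. -/
def conjRep (s : SL(2, ℝ)) (ρ : Γ →* GL ι ℂ) : conjSubgroup s Γ →* GL ι ℂ :=
  ρ.comp (((MulAut.conj s : SL(2, ℝ) ≃* SL(2, ℝ)).subgroupMap Γ).symm :
    conjSubgroup s Γ →* Γ)

end Rep

/-! ### Vector-valued automorphic forms -/

section Forms

variable {ι : Type} [Fintype ι] [DecidableEq ι]

/-- The stroke operator `(X|ₖγ)(τ) = j(γ, τ)⁻ᵏ X(γ τ)`. -/
def stroke (k : ℤ) (γ : SL(2, ℝ)) (X : ℍ → ι → ℂ) : ℍ → ι → ℂ :=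
  fun τ ↦ ((γ 1 0 : ℂ) * (τ : ℂ) + (γ 1 1 : ℂ)) ^ (-k) • X (γ • τ)

/-- At most exponential growth in `Im τ` as `Im τ → ∞`, on every vertical strip. The restriction to
strips only matters if `X` involves powers of `τ`, as logarithmic forms do. -/
def ModerateGrowth (X : ℍ → ι → ℂ) : Prop :=
  ∀ B : ℝ, ∃ C Y : ℝ, ∀ τ : ℍ, |τ.re| ≤ B → Y < τ.im → ‖X τ‖ < Real.exp (C * τ.im)

/-- `X` is a weakly holomorphic vector-valued automorphic form (admissible or logarithmic) of weight
`k` for the group `Γ ⊆ SL₂(ℝ)` and the representation `ρ`. -/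
structure IsWeaklyHolomorphicVVAF (k : ℤ) (Γ : Subgroup SL(2, ℝ)) (ρ : Γ →* GL ι ℂ)
    (X : ℍ → ι → ℂ) : Prop where
  unitary : HasUnitaryCuspEigenvalues ρ
  neg_one : repMat ρ (-1) = ((-1 : ℂ) ^ k) • (1 : Matrix ι ι ℂ)
  holo : DifferentiableOn ℂ (X ∘ ofComplex) {z : ℂ | 0 < z.im}
  functional : ∀ γ ∈ Γ, ∀ τ : ℍ, stroke k γ X τ = (repMat ρ γ).mulVec (X τ)
  cusps : ∀ c : OnePoint ℝ, IsCusp c (toGL Γ) → ModerateGrowth (stroke k (scaling c) X)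

/-! ### Fourier expansions -/

/-- For `|κ| = 1`, the unique `μ ∈ [0, 1)` with `κ = exp (2 π i μ)`. -/
def mu (κ : ℂ) : ℝ := Int.fract (Complex.arg κ / (2 * Real.pi))

/-- `log q = 2 π i τ / w`, where `q = exp (2 π i τ / w)` is the local parameter at a cusp `∞` of
width `w`. -/
def logq (w : ℝ) (τ : ℍ) : ℂ := 2 * Real.pi * Complex.I * (τ : ℂ) / (w : ℂ)

/-- `ρ (t_∞)`, where `t_∞ = t ^ w` and `w` is the width of the cusp `∞` of `Γ`. -/
def monodromy {Γ : Subgroup SL(2, ℝ)} (ρ : Γ →* GL ι ℂ) : Matrix ι ι ℂ :=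
  repMat ρ (transl (cuspWidth Γ OnePoint.infty))

/-- The size `m(κ)` of the largest Jordan block of `T` with eigenvalue `κ`. -/
def jordanSize (T : Matrix ι ι ℂ) (κ : ℂ) : ℕ :=
  Module.End.maxGenEigenspaceIndex (Matrix.toLin' T) κ

/-- `coef κ j n` is the family of Fourier coefficients `X[κ, j, n]` of `X`, a form for the group `Γ`
with cusp `∞` and the representation `ρ`, at this cusp:
`X(τ) = ∑_κ ∑_{j < m(κ)} (log q)ʲ q^{μ(κ)} ∑ₙ X[κ, j, n] qⁿ`, where `q = exp (2 π i τ / w)`, `w` is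
the width of `∞`, `κ` runs through the distinct eigenvalues of `ρ(t_∞)`, and only finitely many
negative `n` occur. Coefficients outside the range of summation are zero. -/
structure IsFourierExpansion {Γ : Subgroup SL(2, ℝ)} (ρ : Γ →* GL ι ℂ) (X : ℍ → ι → ℂ)
    (coef : ℂ → ℕ → ℤ → ι → ℂ) : Prop where
  support : ∀ κ j n, coef κ j n ≠ 0 →
    κ ∈ eigs (monodromy ρ) ∧ j < jordanSize (monodromy ρ) κ
  finite_start : ∃ M : ℤ, ∀ κ j n, n < M → coef κ j n = 0
  summable : ∀ κ j (τ : ℍ), Summable fun n : ℤ ↦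
    Complex.exp (n * logq (cuspWidth Γ OnePoint.infty) τ) • coef κ j n
  expansion : ∀ τ : ℍ, X τ = ∑ κ ∈ eigs (monodromy ρ),
    ∑ j ∈ Finset.range (jordanSize (monodromy ρ) κ),
      (logq (cuspWidth Γ OnePoint.infty) τ ^ j *
          Complex.exp (mu κ * logq (cuspWidth Γ OnePoint.infty) τ)) •
        ∑' n : ℤ, Complex.exp (n * logq (cuspWidth Γ OnePoint.infty) τ) • coef κ j n

/-- The `n`-th Fourier coefficient `X[n] = ∑_κ X[κ, 0, n]`. If `T = ρ(t_∞) = P exp(2 π i Λ) P⁻¹` is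
diagonalizable, with `Λ` diagonal with entries in `[0, 1)`, this is the coefficient in
`X(τ) = P q^Λ P⁻¹ ∑ₙ X[n] qⁿ`. -/
def totalCoeff {Γ : Subgroup SL(2, ℝ)} (ρ : Γ →* GL ι ℂ) (coef : ℂ → ℕ → ℤ → ι → ℂ) (n : ℤ) :
    ι → ℂ :=
  ∑ κ ∈ eigs (monodromy ρ), coef κ 0 n

end Forms

/-! ### Induction of representations and lifting of forms -/

/-- Representatives `g_1, …, g_d` of the left cosets of `Δ` in `Γ`, so `Γ = ⨆ g_a Δ`. -/
structure CosetReps (Γ Δ : Subgroup SL(2, ℝ)) (d : ℕ) where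
  rep : Fin d → SL(2, ℝ)
  rep_mem : ∀ a, rep a ∈ Γ
  existsUnique_rep : ∀ γ ∈ Γ, ∃! a, (rep a)⁻¹ * γ ∈ Δ

section Induction

variable {Γ Δ : Subgroup SL(2, ℝ)} {d m : ℕ}

/-- The block matrix of the induced representation: the block `(a, b)` is `ρ (g_a⁻¹ γ g_b)` if
`g_a⁻¹ γ g_b ∈ Δ`, and zero otherwise. -/
def inducedMatrix (g : CosetReps Γ Δ d) (ρ : Δ →* GL (Fin m) ℂ) (γ : SL(2, ℝ)) :
    Matrix (Fin d × Fin m) (Fin d × Fin m) ℂ :=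
  Matrix.of fun x y ↦ repMat ρ ((g.rep x.1)⁻¹ * γ * g.rep y.1) x.2 y.2

theorem repMat_mul_of_mem (ρ : Δ →* GL (Fin m) ℂ) (x y : SL(2, ℝ)) (hy : y ∈ Δ) :
    repMat ρ x * repMat ρ y = repMat ρ (x * y) := by
  by_cases hx : x ∈ Δ
  · have hxy : x * y ∈ Δ := Δ.mul_mem hx hy
    rw [repMat, repMat, repMat, dif_pos hx, dif_pos hy, dif_pos hxy, ← Units.val_mul, ← map_mul]
    rfl
  · have hxy : x * y ∉ Δ := fun h ↦ hx ((Δ.mul_mem_cancel_right hy).1 h)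
    simp [repMat, hx, hxy]

theorem inducedMatrix_one (g : CosetReps Γ Δ d) (ρ : Δ →* GL (Fin m) ℂ) :
    inducedMatrix g ρ 1 = 1 := by
  ext ⟨a, i⟩ ⟨b, j⟩
  by_cases hab : a = b
  · subst hab
    have h1 : (⟨1, Δ.one_mem⟩ : Δ) = 1 := rfl
    simp [inducedMatrix, repMat, Δ.one_mem, h1, Matrix.one_apply]
  · have hn : (g.rep a)⁻¹ * g.rep b ∉ Δ := fun h ↦
      hab ((g.existsUnique_rep _ (g.rep_mem b)).unique h (by simp [Δ.one_mem]))
    simp [inducedMatrix, repMat, hn, hab]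

theorem inducedMatrix_mul (g : CosetReps Γ Δ d) (ρ : Δ →* GL (Fin m) ℂ) (γ δ : SL(2, ℝ))
    (hδ : δ ∈ Γ) : inducedMatrix g ρ (γ * δ) = inducedMatrix g ρ γ * inducedMatrix g ρ δ := by
  ext ⟨a, i⟩ ⟨b, j⟩
  obtain ⟨c, hc, hu⟩ := g.existsUnique_rep (δ * g.rep b) (Γ.mul_mem hδ (g.rep_mem b))
  have key : ∀ e, e ≠ c → repMat ρ ((g.rep e)⁻¹ * δ * g.rep b) = 0 := by
    intro e he
    have : (g.rep e)⁻¹ * δ * g.rep b ∉ Δ := fun h ↦ he (hu e (by simpa [mul_assoc] using h))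
    simp [repMat, this]
  rw [Matrix.mul_apply, Fintype.sum_prod_type, Finset.sum_eq_single c]
  · have := repMat_mul_of_mem ρ ((g.rep a)⁻¹ * γ * g.rep c) ((g.rep c)⁻¹ * δ * g.rep b)
      (by simpa [mul_assoc] using hc)
    have h2 : (g.rep a)⁻¹ * γ * g.rep c * ((g.rep c)⁻¹ * δ * g.rep b) =
        (g.rep a)⁻¹ * (γ * δ) * g.rep b := by group
    rw [h2] at this
    have h3 := congrFun (congrFun this i) j
    rw [Matrix.mul_apply] at h3
    simpa [inducedMatrix] using h3.symm
  · intro e _ he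
    simp [inducedMatrix, key e he]
  · simp

/-- The induced representation `ρ̃ = Ind ρ` of `Γ`, in the basis given by the representatives. -/
def inducedRep (g : CosetReps Γ Δ d) (ρ : Δ →* GL (Fin m) ℂ) : Γ →* GL (Fin d × Fin m) ℂ :=
  MonoidHom.toHomUnits
    { toFun := fun γ ↦ inducedMatrix g ρ γ
      map_one' := inducedMatrix_one g ρ
      map_mul' := fun γ δ ↦ inducedMatrix_mul g ρ γ δ δ.2 }

/-- The lift `τ ↦ (X(g_a⁻¹ τ))_{1 ≤ a ≤ d}` of a form of weight zero. -/
def lift (g : CosetReps Γ Δ d) (X : ℍ → Fin m → ℂ) : ℍ → Fin d × Fin m → ℂ :=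
  fun τ x ↦ X ((g.rep x.1)⁻¹ • τ) x.2

/-- The element `s_a = A_c⁻¹ g_a` of `SL₂(ℝ)`. -/
def conjElt (g : CosetReps Γ Δ d) (c : OnePoint ℝ) (a : Fin d) : SL(2, ℝ) :=
  (scaling c)⁻¹ * g.rep a

/-- The form `X⁽ᵃ⁾(τ) = X(s_a⁻¹ τ) = X(g_a⁻¹ A_c τ)`, for the group `s_a Δ s_a⁻¹`. -/
def component (g : CosetReps Γ Δ d) (c : OnePoint ℝ) (X : ℍ → Fin m → ℂ) (a : Fin d) :
    ℍ → Fin m → ℂ :=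
  stroke 0 (conjElt g c a)⁻¹ X

/-- The representation `s_a γ s_a⁻¹ ↦ ρ γ` of `s_a Δ s_a⁻¹`. -/
def componentRep (g : CosetReps Γ Δ d) (c : OnePoint ℝ) (ρ : Δ →* GL (Fin m) ℂ) (a : Fin d) :
    conjSubgroup (conjElt g c a) Δ →* GL (Fin m) ℂ :=
  conjRep (conjElt g c a) ρ

/-- The lifted form, moved from the cusp `c` to `∞`: `τ ↦ (X(g_a⁻¹ A_c τ))_a`. It is the lift itself
if `c = ∞`. -/
def liftAt (g : CosetReps Γ Δ d) (c : OnePoint ℝ) (X : ℍ → Fin m → ℂ) : ℍ → Fin d × Fin m → ℂ :=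
  stroke 0 (scaling c) (lift g X)

/-- The representation `A_c⁻¹ γ A_c ↦ ρ̃ γ` of `A_c⁻¹ Γ A_c`. -/
def liftAtRep (g : CosetReps Γ Δ d) (c : OnePoint ℝ) (ρ : Δ →* GL (Fin m) ℂ) :
    conjSubgroup (scaling c)⁻¹ Γ →* GL (Fin d × Fin m) ℂ :=
  conjRep (scaling c)⁻¹ (inducedRep g ρ)

end Induction

end VVAF

end

noncomputable section

namespace VVAF

/-! ### The exponent of a number of modulus one -/

/-! Block `a` of the lift at the cusp is `X⁽ᵃ⁾` itself (`liftAt_apply`), so part 2 compares two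
expansions of one function: in `q` for the lift, in `q_a = q^{1/h}` for the component, with `h =
h_a`. Write an exponent of `q_a` as `h n + r` with `0 ≤ r < h`. Then `q_a^{μ(l) + h n + r} =
q^{(μ(l) + r)/h + n}`, and `(μ(l) + r)/h` lies in `[0, 1)`: it is `μ` of the `h`-th root of `l` in
sector `r`, the set of `κ` with `⌊h μ(κ)⌋ = r`. Since `log q_a = h⁻¹ log q`, regrouping
(`HasLogExpansion.regroup`) yields an expansion in `q` with exactly the asserted coefficients, and
`HasLogExpansion.unique` finishes.

Existence and uniqueness of expansions rest on the translation `f(τ) ↦ f(τ + w)`. A polynomial in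
`log q` with periodic coefficients, times `q^{μ(κ)}`, lies in its generalized eigenspace for `κ`.
These eigenspaces are independent, which separates the `κ`; conversely every tame function in one of
them has this shape (`exists_logSum`). The periodic coefficients are Laurent series in `q`.

For part 3, the generator of the translations at the cusp permutes the cosets. The monodromy `T` of
the lift is therefore a monomial block matrix, `h_a` is the length of the cycle of `a`, and block
row `a` of `T^{h_a}` is just `T_a` on the diagonal. Number the members of each cycle by `ν`, and let
`P⁻¹` keep in block `a` only the components from generalized eigenspaces with `κ` in sector `ν_a`.
In a single sector `h`-th roots are unique, so projection to block `a` intertwines `T` with the root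
`R_a` of `T_a` in that sector (`intertwine_of_intertwine_pow`). The map is injective: an eigenvector
of `T` in the kernel has, on each cycle, a zero block where `ν` is the sector of its eigenvalue, and
`T` carries this zero around the cycle.

The coefficients for `κ` lie in the generalized eigenspace of `κ`, so `P⁻¹` keeps or kills each of
their blocks. Summing over `κ` is a bijection, as `κ ↦ κ^h` maps one sector bijectively to the unit
circle. -/

theorem mu_nonneg (κ : ℂ) : 0 ≤ mu κ := Int.fract_nonneg _

theorem mu_lt_one (κ : ℂ) : mu κ < 1 := Int.fract_lt_one _

theorem exp_mu {κ : ℂ} (hκ : ‖κ‖ = 1) : Complex.exp (2 * Real.pi * Complex.I * mu κ) = κ := by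
  have hpi : (Real.pi : ℂ) ≠ 0 := by exact_mod_cast Real.pi_ne_zero
  have h1 : (mu κ : ℂ) = Complex.arg κ / (2 * Real.pi) - (⌊Complex.arg κ / (2 * Real.pi)⌋ : ℤ) := by
    rw [mu, Int.fract]; push_cast; rfl
  have h2 : 2 * Real.pi * Complex.I * (mu κ : ℂ) = Complex.arg κ * Complex.I +
      ((-⌊Complex.arg κ / (2 * Real.pi)⌋ : ℤ) : ℂ) * (2 * Real.pi * Complex.I) := by
    rw [h1]; push_cast; field_simp; ring
  rw [h2, Complex.exp_add, Complex.exp_int_mul_two_pi_mul_I, mul_one]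
  simpa [hκ] using Complex.norm_mul_exp_arg_mul_I κ

theorem mu_exp {x : ℝ} (h0 : 0 ≤ x) (h1 : x < 1) :
    mu (Complex.exp (2 * Real.pi * Complex.I * x)) = x := by
  set κ := Complex.exp (2 * Real.pi * Complex.I * x) with hκ
  have hn : ‖κ‖ = 1 := by
    rw [hκ, show 2 * Real.pi * Complex.I * x = ((2 * Real.pi * x : ℝ) : ℂ) * Complex.I by
      push_cast; ring, Complex.norm_exp_ofReal_mul_I]
  have h2 := exp_mu hn
  rw [hκ, Complex.exp_eq_exp_iff_exists_int] at h2
  obtain ⟨n, hn⟩ := h2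
  rw [← hκ] at hn
  have h3 : (mu κ : ℂ) = x + n := by
    have := Complex.two_pi_I_ne_zero
    apply mul_left_cancel₀ this
    rw [hn]; ring
  have h4 : mu κ = x + n := by exact_mod_cast h3
  have h5 := mu_nonneg κ
  have h6 := mu_lt_one κ
  have h7 : (n : ℝ) < 1 := by linarith
  have h8 : (-1 : ℝ) < n := by linarith
  have h9 : n < 1 := by exact_mod_cast h7
  have h10 : -1 < n := by exact_mod_cast h8
  have : n = 0 := by omega
  simp [h4, this]

/-- The `h`-th root of `κ` with argument in the `r`-th sector. -/
def branch (h : ℕ) (κ : ℂ) (r : ℕ) : ℂ :=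
  Complex.exp (2 * Real.pi * Complex.I * (((mu κ + r) / h : ℝ) : ℂ))

theorem norm_branch (h : ℕ) (κ : ℂ) (r : ℕ) : ‖branch h κ r‖ = 1 := by
  rw [branch, show 2 * Real.pi * Complex.I * (((mu κ + r) / h : ℝ) : ℂ) =
    ((2 * Real.pi * ((mu κ + r) / h) : ℝ) : ℂ) * Complex.I by push_cast; ring,
    Complex.norm_exp_ofReal_mul_I]

theorem branch_pow {h : ℕ} (hh : 0 < h) {κ : ℂ} (hκ : ‖κ‖ = 1) (r : ℕ) :
    branch h κ r ^ h = κ := by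
  have hh' : (h : ℂ) ≠ 0 := by exact_mod_cast hh.ne'
  rw [branch, ← Complex.exp_nat_mul]
  have : (h : ℂ) * (2 * Real.pi * Complex.I * (((mu κ + r) / h : ℝ) : ℂ)) =
      2 * Real.pi * Complex.I * mu κ + (r : ℕ) * (2 * Real.pi * Complex.I) := by
    push_cast; field_simp
  rw [this, Complex.exp_add, Complex.exp_nat_mul_two_pi_mul_I, mul_one, exp_mu hκ]

theorem mu_branch {h : ℕ} (κ : ℂ) {r : ℕ} (hr : r < h) :
    mu (branch h κ r) = (mu κ + r) / h := by
  have hh : (0 : ℝ) < h := by exact_mod_cast (Nat.zero_le r).trans_lt hr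
  have h1 := mu_nonneg κ
  have h2 := mu_lt_one κ
  have h3 : (r : ℝ) + 1 ≤ h := by exact_mod_cast hr
  refine mu_exp (by positivity) ?_
  rw [div_lt_one hh]; linarith

theorem floor_mu_branch {h : ℕ} (κ : ℂ) {r : ℕ} (hr : r < h) :
    ⌊h * mu (branch h κ r)⌋ = (r : ℤ) := by
  have hh : (h : ℝ) ≠ 0 := by exact_mod_cast ((Nat.zero_le r).trans_lt hr).ne'
  rw [mu_branch κ hr, mul_div_cancel₀ _ hh, Int.floor_eq_iff]
  have h1 := mu_nonneg κ
  have h2 := mu_lt_one κ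
  push_cast
  constructor <;> linarith

theorem exists_floor_mu {h : ℕ} (hh : 0 < h) (κ : ℂ) :
    ∃ r : ℕ, r < h ∧ ⌊h * mu κ⌋ = (r : ℤ) := by
  have h1 := mu_nonneg κ
  have h2 := mu_lt_one κ
  have hh' : (0 : ℝ) < h := by exact_mod_cast hh
  have h3 : 0 ≤ ⌊h * mu κ⌋ := Int.floor_nonneg.2 (by positivity)
  obtain ⟨r, hr⟩ := Int.eq_ofNat_of_zero_le h3
  refine ⟨r, ?_, hr⟩
  have : ⌊h * mu κ⌋ < (h : ℤ) := by
    rw [Int.floor_lt]; push_cast; nlinarith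
  omega

/-- On sector `r` one has `μ(κ ^ h) = h μ(κ) - r`. Together with `branch_pow` and `floor_mu_branch`
this makes `κ ↦ κ ^ h` a bijection from the sector to the unit circle, with inverse `branch h · r`.
-/
theorem eq_branch {h : ℕ} (hh : 0 < h) {κ : ℂ} (hκ : ‖κ‖ = 1) {r : ℕ}
    (hr : ⌊h * mu κ⌋ = (r : ℤ)) : κ = branch h (κ ^ h) r := by
  have hh' : (0 : ℝ) < h := by exact_mod_cast hh
  have h1 : κ ^ h = Complex.exp (2 * Real.pi * Complex.I * ((h * mu κ - r : ℝ) : ℂ)) := by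
    conv_lhs => rw [← exp_mu hκ]
    rw [← Complex.exp_nat_mul, ← mul_one (Complex.exp (2 * Real.pi * Complex.I * _)),
      ← Complex.exp_nat_mul_two_pi_mul_I r, ← Complex.exp_add]
    congr 1
    push_cast; ring
  rw [Int.floor_eq_iff] at hr
  push_cast at hr
  have h2 : mu (κ ^ h) = h * mu κ - r := by
    rw [h1]; exact mu_exp (by linarith) (by linarith)
  rw [branch, h2]
  conv_lhs => rw [← exp_mu hκ]
  congr 2
  norm_cast
  field_simp
  ring

/-! ### Eigenvalues and generalized eigenspaces -/

section LinearAlgebra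

theorem exists_eigenvector_of_mapsTo {V : Type*} [AddCommGroup V] [Module ℂ V]
    [FiniteDimensional ℂ V] (f : Module.End ℂ V) (W : Submodule ℂ V) (hW : W ≠ ⊥)
    (hf : ∀ v ∈ W, f v ∈ W) : ∃ κ : ℂ, ∃ v ∈ W, v ≠ 0 ∧ f v = κ • v := by
  have : Nontrivial W := Submodule.nontrivial_iff_ne_bot.2 hW
  obtain ⟨κ, hκ⟩ := Module.End.exists_eigenvalue (f.restrict hf)
  obtain ⟨v, hv⟩ := hκ.exists_hasEigenvector
  refine ⟨κ, v, v.2, by simpa using hv.2, ?_⟩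
  simpa using congrArg Subtype.val hv.apply_eq_smul

/-- The projections of a finite-dimensional complex vector space onto the generalized eigenspaces
of an endomorphism. -/
theorem exists_genEigenspace_projections {V : Type*} [AddCommGroup V] [Module ℂ V]
    [FiniteDimensional ℂ V] (f : Module.End ℂ V) :
    ∃ p : ℂ → Module.End ℂ V, (∀ κ v, p κ v ∈ f.maxGenEigenspace κ) ∧
      (∀ κ, ∀ v ∈ f.maxGenEigenspace κ, p κ v = v) ∧
      ∀ κ κ', κ ≠ κ' → ∀ v ∈ f.maxGenEigenspace κ, p κ' v = 0 := by
  classical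
  have hint : DirectSum.IsInternal f.maxGenEigenspace :=
    DirectSum.isInternal_submodule_of_iSupIndep_of_iSup_eq_top f.independent_maxGenEigenspace
      f.iSup_maxGenEigenspace_eq_top
  let e := LinearEquiv.ofBijective (DirectSum.coeLinearMap f.maxGenEigenspace) hint
  have he : ∀ κ (v : f.maxGenEigenspace κ), e.symm v = DirectSum.lof ℂ ℂ _ κ v := by
    intro κ v
    rw [LinearEquiv.symm_apply_eq]
    exact (DirectSum.coeLinearMap_lof _ _ _).symm
  refine ⟨fun κ ↦ (f.maxGenEigenspace κ).subtype ∘ₗ DirectSum.component ℂ ℂ _ κ ∘ₗ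
    e.symm.toLinearMap, fun κ v ↦ by simp, fun κ v hv ↦ ?_, fun κ κ' hne v hv ↦ ?_⟩
  · have := he κ ⟨v, hv⟩
    simp only [] at this
    simp [this, DirectSum.component.lof_self]
  · have := he κ ⟨v, hv⟩
    simp only [] at this
    simp [this, DirectSum.component.of, hne]

theorem ext_maxGenEigenspace {V W : Type*} [AddCommGroup V] [Module ℂ V]
    [FiniteDimensional ℂ V] [AddCommGroup W] [Module ℂ W] (f : Module.End ℂ V)
    {a b : V →ₗ[ℂ] W} (h : ∀ κ, ∀ v ∈ f.maxGenEigenspace κ, a v = b v) : a = b := by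
  have h1 : (⊤ : Submodule ℂ V) ≤ LinearMap.eqLocus a b := by
    rw [← f.iSup_maxGenEigenspace_eq_top]
    exact iSup_le fun κ v hv ↦ h κ v hv
  exact LinearMap.ext fun v ↦ h1 trivial

variable {ι : Type} [Fintype ι] [DecidableEq ι]

theorem mem_eigs_iff_isRoot (T : Matrix ι ι ℂ) (κ : ℂ) : κ ∈ eigs T ↔ T.charpoly.IsRoot κ := by
  rw [eigs, Multiset.mem_toFinset, Polynomial.mem_roots T.charpoly_monic.ne_zero]

theorem mem_eigs_iff (T : Matrix ι ι ℂ) (κ : ℂ) :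
    κ ∈ eigs T ↔ ∃ v, v ≠ 0 ∧ T.mulVec v = κ • v := by
  rw [mem_eigs_iff_isRoot, ← Matrix.charpoly_toLin', ← Module.End.hasEigenvalue_iff_isRoot_charpoly]
  constructor
  · intro h
    obtain ⟨v, hv⟩ := h.exists_hasEigenvector
    exact ⟨v, hv.2, by simpa using hv.apply_eq_smul⟩
  · rintro ⟨v, hv, h⟩
    exact Module.End.hasEigenvalue_of_hasEigenvector (x := v)
      ⟨Module.End.mem_eigenspace_iff.2 (by simpa using h), hv⟩

theorem mem_eigs_of_mem_maxGenEigenspace {T : Matrix ι ι ℂ} {κ : ℂ} {v : ι → ℂ} (hv : v ≠ 0)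
    (h : v ∈ Module.End.maxGenEigenspace T.toLin' κ) : κ ∈ eigs T := by
  rw [mem_eigs_iff_isRoot, ← Matrix.charpoly_toLin', ← Module.End.hasEigenvalue_iff_isRoot_charpoly]
  rw [Module.End.mem_maxGenEigenspace] at h
  obtain ⟨k, hk⟩ := h
  refine Module.End.hasEigenvalue_of_hasGenEigenvalue (k := k) ?_
  refine (Submodule.ne_bot_iff _).2 ⟨v, ?_, hv⟩
  rw [Module.End.mem_genEigenspace]
  exact ⟨k, le_rfl, hk⟩

theorem pow_mulVec_of_eigenvector {T : Matrix ι ι ℂ} {κ : ℂ} {v : ι → ℂ}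
    (h : T.mulVec v = κ • v) (n : ℕ) : (T ^ n).mulVec v = κ ^ n • v := by
  induction n with
  | zero => simp
  | succ n ih => rw [pow_succ, ← Matrix.mulVec_mulVec, h, Matrix.mulVec_smul, ih, smul_smul, pow_succ']

theorem aeval_mulVec_of_eigenvector {T : Matrix ι ι ℂ} {κ : ℂ} {v : ι → ℂ}
    (h : T.mulVec v = κ • v) (p : Polynomial ℂ) :
    (Polynomial.aeval T p).mulVec v = p.eval κ • v := by
  induction p using Polynomial.induction_on' with
  | add p q hp hq => rw [map_add, Matrix.add_mulVec, hp, hq, Polynomial.eval_add, add_smul]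
  | monomial n a =>
    rw [Polynomial.aeval_monomial, Polynomial.eval_monomial, ← Matrix.mulVec_mulVec,
      pow_mulVec_of_eigenvector h, Matrix.mulVec_smul, Algebra.algebraMap_eq_smul_one, Matrix.smul_mulVec,
      Matrix.one_mulVec, smul_smul, mul_comm]

/-- An eigenvalue of a polynomial in `T` is the value of the polynomial at an eigenvalue. -/
theorem exists_eval_eq_of_mem_eigs_aeval {T : Matrix ι ι ℂ} {p : Polynomial ℂ} {κ : ℂ}
    (h : κ ∈ eigs (Polynomial.aeval T p)) : ∃ l ∈ eigs T, p.eval l = κ := by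
  rw [mem_eigs_iff] at h
  obtain ⟨v, hv, hvκ⟩ := h
  -- The eigenspace of `p(T)` is stable under `T`, which commutes with `p(T)`; an eigenvector of `T`
  -- inside it gives `l`.
  let W : Submodule ℂ (ι → ℂ) := LinearMap.ker ((Polynomial.aeval T p).toLin' - κ • LinearMap.id)
  have hW : ∀ u, u ∈ W ↔ (Polynomial.aeval T p).mulVec u = κ • u := by
    intro u; simp [W, sub_eq_zero]
  obtain ⟨l, u, huW, hu, hl⟩ := exists_eigenvector_of_mapsTo T.toLin' W
    (Submodule.ne_bot_iff _ |>.2 ⟨v, (hW v).2 hvκ, hv⟩) (by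
      intro u hu
      rw [hW] at hu ⊢
      have hc : Polynomial.aeval T p * T = T * Polynomial.aeval T p := by
        have := congrArg (Polynomial.aeval T) (mul_comm p Polynomial.X)
        simpa using this
      simp only [Matrix.toLin'_apply]
      rw [Matrix.mulVec_mulVec, hc, ← Matrix.mulVec_mulVec, hu, Matrix.mulVec_smul])
  simp only [Matrix.toLin'_apply] at hl
  refine ⟨l, (mem_eigs_iff _ _).2 ⟨u, hu, hl⟩, ?_⟩
  have h1 := (hW u).1 huW
  rw [aeval_mulVec_of_eigenvector hl] at h1
  exact smul_left_injective ℂ hu h1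

end LinearAlgebra

/-! ### Roots of a matrix with prescribed spectrum -/

section Roots

open Polynomial

/-- Applied to the roots of a characteristic polynomial: what vanishes on the spectrum is nilpotent
modulo that polynomial. The next lemma is the counterpart for units. -/
theorem multiset_prod_X_sub_C_dvd_pow (s : Multiset ℂ) (p : ℂ[X])
    (h : ∀ l ∈ s, p.eval l = 0) :
    (s.map fun l ↦ X - C l).prod ∣ p ^ s.card := by
  induction s using Multiset.induction_on with
  | empty => simp
  | cons a s ih =>
    rw [Multiset.map_cons, Multiset.prod_cons, Multiset.card_cons, pow_succ']
    exact mul_dvd_mul (dvd_iff_isRoot.2 (h a (by simp))) (ih fun l hl ↦ h l (by simp [hl]))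

theorem isCoprime_multiset_prod_X_sub_C (s : Multiset ℂ) (p : ℂ[X]) (h : ∀ l ∈ s, p.eval l ≠ 0) :
    IsCoprime p (s.map fun l ↦ X - C l).prod := by
  induction s using Multiset.induction_on with
  | empty => simpa using isCoprime_one_right
  | cons a s ih =>
    rw [Multiset.map_cons, Multiset.prod_cons]
    refine IsCoprime.mul_right ?_ (ih fun l hl ↦ h l (by simp [hl]))
    refine ((irreducible_X_sub_C a).coprime_iff_not_dvd.2 ?_).symm
    rw [dvd_iff_isRoot]
    exact h a (by simp)

variable {ι : Type} [Fintype ι] [DecidableEq ι]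

theorem charpoly_eq_prod (T : Matrix ι ι ℂ) :
    (T.charpoly.roots.map fun l ↦ X - C l).prod = T.charpoly :=
  ((IsAlgClosed.splits T.charpoly).eq_prod_roots_of_monic T.charpoly_monic).symm

/-- A Bézout relation between `p` and the characteristic polynomial becomes an inverse of `p(T)` by
Cayley–Hamilton. -/
theorem isUnit_aeval_of_eval_ne_zero (T : Matrix ι ι ℂ) (p : ℂ[X])
    (h : ∀ l ∈ eigs T, p.eval l ≠ 0) : IsUnit (aeval T p) := by
  have hc := isCoprime_multiset_prod_X_sub_C T.charpoly.roots p fun l hl ↦ h l (by simpa [eigs] using hl)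
  rw [charpoly_eq_prod] at hc
  obtain ⟨a, b, hab⟩ := hc
  have h2 := congrArg (aeval T) hab
  simp only [map_add, map_mul, Matrix.aeval_self_charpoly, mul_zero, add_zero, map_one] at h2
  exact (Matrix.isUnit_iff_isUnit_det _).2 (Matrix.isUnit_det_of_left_inverse h2)

/-- A matrix with eigenvalues of modulus one has an `h`-th root with eigenvalues in a given sector.
The root is a polynomial in the matrix, found by Newton's method. -/
theorem exists_root_of_sector (T : Matrix ι ι ℂ) (hT : ∀ κ ∈ eigs T, ‖κ‖ = 1) {h r : ℕ}
    (hr : r < h) : ∃ R : Matrix ι ι ℂ, R ^ h = T ∧ ∀ κ ∈ eigs R, ⌊h * mu κ⌋ = (r : ℤ) := by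
  have hh : 0 < h := (Nat.zero_le r).trans_lt hr
  have hroots : ∀ l ∈ T.charpoly.roots, l ∈ eigs T := fun l hl ↦ by simpa [eigs] using hl
  -- The starting value for Newton's method: it has the right values on the spectrum, but ignores
  -- the multiplicities.
  set q : ℂ[X] := Lagrange.interpolate (eigs T) id fun l ↦ branch h l r with hq
  have hqe : ∀ l ∈ eigs T, q.eval l = branch h l r := fun l hl ↦
    Lagrange.eval_interpolate_at_node (fun l ↦ branch h l r) (Set.injOn_id _) hl
  let S := AdjoinRoot T.charpoly
  have hmk : ∀ p : ℂ[X], aeval (AdjoinRoot.root T.charpoly) p = AdjoinRoot.mk T.charpoly p :=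
    fun p ↦ AdjoinRoot.aeval_eq p
  let y : S := AdjoinRoot.mk T.charpoly q
  let P : S[X] := X ^ h - C (AdjoinRoot.root T.charpoly)
  -- `q ^ h - X` vanishes on the spectrum, and `h q ^ (h - 1)` vanishes nowhere there. So `q` is a
  -- simple root of `P` up to nilpotents, and lifts to a true root `p`.
  have h1 : IsNilpotent (aeval y P) := by
    refine ⟨T.charpoly.roots.card, ?_⟩
    have : aeval y P = AdjoinRoot.mk T.charpoly (q ^ h - X) := by
      simp [P, y, AdjoinRoot.mk_X]
    rw [this, ← map_pow, AdjoinRoot.mk_eq_zero]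
    conv_lhs => rw [← charpoly_eq_prod]
    refine multiset_prod_X_sub_C_dvd_pow _ _ fun l hl ↦ ?_
    have hl' := hroots l hl
    simp [hqe l hl', branch_pow hh (hT l hl')]
  have h2 : IsUnit (aeval y (derivative P)) := by
    have : aeval y (derivative P) = AdjoinRoot.mk T.charpoly (C (h : ℂ) * q ^ (h - 1)) := by
      simp [P, y, derivative_X_pow]
    rw [this]
    have hc := isCoprime_multiset_prod_X_sub_C T.charpoly.roots (C (h : ℂ) * q ^ (h - 1)) fun l hl ↦ by
      have hb : branch h l r ≠ 0 := by
        intro h0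
        have := norm_branch h l r
        simp [h0] at this
      simp [hqe l (hroots l hl), hh.ne', hb]
    rw [charpoly_eq_prod] at hc
    obtain ⟨a, b, hab⟩ := hc
    refine IsUnit.of_mul_eq_one (AdjoinRoot.mk T.charpoly a) ?_
    have := congrArg (AdjoinRoot.mk T.charpoly) hab
    rw [map_add, map_mul, map_mul _ b, AdjoinRoot.mk_self, mul_zero, add_zero, map_one] at this
    rw [mul_comm, this]
  obtain ⟨z, ⟨hz1, hz2⟩, -⟩ := existsUnique_nilpotent_sub_and_aeval_eq_zero h1 h2
  obtain ⟨p, rfl⟩ := AdjoinRoot.mk_surjective z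
  refine ⟨aeval T p, ?_, fun κ hκ ↦ ?_⟩
  · have h3 : AdjoinRoot.mk T.charpoly (p ^ h - X) = 0 := by
      rw [← hz2]; simp [P, AdjoinRoot.mk_X]
    rw [AdjoinRoot.mk_eq_zero] at h3
    obtain ⟨b, hb⟩ := h3
    have h4 := congrArg (aeval T) hb
    simp only [map_sub, map_pow, aeval_X, map_mul, Matrix.aeval_self_charpoly, zero_mul] at h4
    exact sub_eq_zero.1 h4
  · obtain ⟨l, hl, rfl⟩ := exists_eval_eq_of_mem_eigs_aeval hκ
    -- `q - p` is nilpotent modulo the characteristic polynomial, so `p` and `q` agree at the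
    -- eigenvalue `l`.
    obtain ⟨n, hn⟩ := hz1
    replace hn : AdjoinRoot.mk T.charpoly ((q - p) ^ n) = 0 := by
      rw [map_pow, map_sub]; exact hn
    rw [AdjoinRoot.mk_eq_zero] at hn
    have h5 : ((q - p) ^ n).eval l = 0 :=
      eval_eq_zero_of_dvd_of_eval_eq_zero hn ((mem_eigs_iff_isRoot T l).1 hl)
    rw [eval_pow, eval_sub, hqe l hl] at h5
    rw [← sub_eq_zero.1 (eq_zero_of_pow_eq_zero h5), floor_mu_branch l hr]

end Roots

/-! ### Similarity to a block diagonal matrix of roots -/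

section Blocks

variable {α ι : Type} [Fintype α] [DecidableEq α] [Fintype ι] [DecidableEq ι]

theorem eigs_pow_mem {T : Matrix ι ι ℂ} {κ : ℂ} (h : κ ∈ eigs T) (n : ℕ) : κ ^ n ∈ eigs (T ^ n) := by
  rw [mem_eigs_iff] at h ⊢
  obtain ⟨v, hv, hκ⟩ := h
  exact ⟨v, hv, pow_mulVec_of_eigenvector hκ n⟩

theorem norm_eq_one_of_norm_pow {κ : ℂ} {h : ℕ} (hh : 0 < h) (hκ : ‖κ ^ h‖ = 1) : ‖κ‖ = 1 := by
  rw [norm_pow] at hκ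
  exact (pow_eq_one_iff_of_nonneg (norm_nonneg κ) hh.ne').1 hκ

/-- Two operators with equal `h`-th powers, with spectra in one sector, are intertwined by a linear
map that intertwines these powers. -/
theorem intertwine_of_intertwine_pow {V : Type*} [AddCommGroup V] [Module ℂ V]
    (f : Module.End ℂ V) (R : Matrix ι ι ℂ) {h r : ℕ} (hr : r < h)
    (hR : ∀ l ∈ eigs R, ‖l‖ = 1 ∧ ⌊h * mu l⌋ = (r : ℤ)) {κ : ℂ} (hκ : ‖κ‖ = 1)
    (hκr : ⌊h * mu κ⌋ = (r : ℤ)) (p : V →ₗ[ℂ] ι → ℂ)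
    (hp : ∀ v, p ((f ^ h) v) = (R ^ h).mulVec (p v)) {v : V} (hv : v ∈ f.maxGenEigenspace κ) :
    p (f v) = R.mulVec (p v) := by
  have hh : 0 < h := (Nat.zero_le r).trans_lt hr
  -- the difference of the two sides is killed by an injective operator
  let φ : V →ₗ[ℂ] ι → ℂ := p ∘ₗ f - R.toLin' ∘ₗ p
  have hφ : ∀ u, φ u = p (f u) - R.mulVec (p u) := fun u ↦ by simp [φ]
  -- Telescoping: `p fⁿ - Rⁿ p` is a sum of terms `R^{n-1-i} φ fⁱ`. For `n = h` it is zero by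
  -- hypothesis.
  have htel : ∀ n u, ∑ i ∈ Finset.range n, (R ^ (n - 1 - i)).mulVec (φ ((f ^ i) u)) =
      p ((f ^ n) u) - (R ^ n).mulVec (p u) := by
    intro n
    induction n with
    | zero => intro u; simp
    | succ n ih =>
      intro u
      rw [Finset.sum_range_succ]
      have h1 : ∀ i ∈ Finset.range n, (R ^ (n + 1 - 1 - i)).mulVec (φ ((f ^ i) u)) =
          R.mulVec ((R ^ (n - 1 - i)).mulVec (φ ((f ^ i) u))) := by
        intro i hi
        have hi' := Finset.mem_range.1 hi
        rw [Matrix.mulVec_mulVec, ← pow_succ']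
        congr 2; omega
      rw [Finset.sum_congr rfl h1, ← Matrix.mulVec_sum, ih, hφ]
      simp only [add_tsub_cancel_right, tsub_self, pow_zero, Matrix.one_mulVec]
      rw [Matrix.mulVec_sub, Matrix.mulVec_mulVec, ← pow_succ']
      have : (f ^ (n + 1)) u = f ((f ^ n) u) := by rw [pow_succ']; rfl
      rw [this]; abel
  -- `s(l) = (κ^h - l^h) / (κ - l)` for `l ≠ κ`. Where `f` acts on `u` as `κ`, the telescoped sum is
  -- `s(R) (φ u)`.
  let s : Polynomial ℂ := ∑ i ∈ Finset.range h, Polynomial.C (κ ^ i) * Polynomial.X ^ (h - 1 - i)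
  have hs : ∀ l, s.eval l * (κ - l) = κ ^ h - l ^ h := by
    intro l
    rw [← (Commute.all κ l).geom_sum₂_mul h]
    simp [s, Polynomial.eval_finsetSum]
  -- A zero `l` of `s` in the spectrum of `R` has `l^h = κ^h`, and being in the sector of `κ` it
  -- equals `κ`; but `s(κ) = h κ^{h-1}` is not zero.
  have hunit : IsUnit (Polynomial.aeval R s) := by
    refine isUnit_aeval_of_eval_ne_zero R s fun l hl h0 ↦ ?_
    obtain ⟨hl1, hl2⟩ := hR l hl
    have h1 := hs l
    rw [h0, zero_mul, eq_comm, sub_eq_zero] at h1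
    have h2 : κ = l := by
      rw [eq_branch hh hκ hκr, eq_branch hh hl1 hl2, h1]
    subst h2
    have h3 : s.eval κ = h * κ ^ (h - 1) := by
      have : ∀ i ∈ Finset.range h, κ ^ i * κ ^ (h - 1 - i) = κ ^ (h - 1) := by
        intro i hi
        have hi' := Finset.mem_range.1 hi
        rw [← pow_add]; congr 1; omega
      simp [s, Polynomial.eval_finsetSum, Finset.sum_congr rfl this]
    have hκ0 : κ ≠ 0 := by rintro rfl; simp at hκ
    rw [h3] at h0
    simp [hh.ne', hκ0] at h0
  have hsφ : ∀ w : ι → ℂ, (∑ i ∈ Finset.range h, (R ^ (h - 1 - i)).mulVec (κ ^ i • w)) = 0 →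
      w = 0 := by
    intro w hw
    have h1 : (Polynomial.aeval R s).mulVec w = 0 := by
      rw [← hw]
      simp only [s, map_sum, map_mul, Polynomial.aeval_C, map_pow, Polynomial.aeval_X,
        Matrix.sum_mulVec]
      refine Finset.sum_congr rfl fun i _ ↦ ?_
      rw [Matrix.mulVec_smul, ← map_pow, Algebra.algebraMap_eq_smul_one, Matrix.smul_mul,
        one_mul, Matrix.smul_mulVec]
    obtain ⟨u, hu⟩ := hunit
    rw [← hu] at h1
    have h2 := congrArg ((↑u⁻¹ : Matrix ι ι ℂ).mulVec) h1
    simpa [Matrix.mulVec_mulVec] using h2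
  -- Induction along the kernels of `(f - κ)^k`: at level `k + 1`, `fⁱ u - κⁱ u` lies in level `k`,
  -- where `φ` is already zero, so `φ` sees `f` acting as the scalar `κ`.
  have key : ∀ k : ℕ, ∀ u, ((f - algebraMap ℂ (Module.End ℂ V) κ) ^ k) u = 0 → φ u = 0 := by
    intro k
    induction k with
    | zero => intro u hu; simp only [pow_zero, Module.End.one_apply] at hu; simp [hu]
    | succ k ih =>
      intro u hu
      have h1 : ∀ i, φ ((f ^ i) u) = κ ^ i • φ u := by
        intro i
        rw [← map_smul, ← sub_eq_zero, ← map_sub]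
        apply ih
        have hc : Commute f (algebraMap ℂ (Module.End ℂ V) κ) := (Algebra.commutes κ f).symm
        have h2 : f ^ i - algebraMap ℂ _ (κ ^ i) =
            (∑ j ∈ Finset.range i, f ^ j * algebraMap ℂ (Module.End ℂ V) κ ^ (i - 1 - j)) *
              (f - algebraMap ℂ _ κ) := by
          rw [hc.geom_sum₂_mul, map_pow]
        have h3 : (f ^ i) u - κ ^ i • u = (f ^ i - algebraMap ℂ _ (κ ^ i)) u := by
          rw [LinearMap.sub_apply, Module.algebraMap_end_apply]
        rw [h3, h2, ← Module.End.mul_apply, ← mul_assoc]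
        have h4 : Commute ((f - algebraMap ℂ _ κ) ^ k)
            (∑ j ∈ Finset.range i, f ^ j * algebraMap ℂ (Module.End ℂ V) κ ^ (i - 1 - j)) := by
          refine Commute.pow_left (Commute.sum_right _ _ _ fun j _ ↦ ?_) _
          refine Commute.mul_right ?_ ?_
          · exact ((Commute.refl f).sub_left hc.symm).pow_right _
          · exact (hc.sub_left (Commute.refl _)).pow_right _
        rw [h4.eq, mul_assoc, ← pow_succ, Module.End.mul_apply, hu, map_zero]
      apply hsφ
      have h5 := htel h u
      rw [hp, sub_self] at h5
      simpa only [h1] using h5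
  rw [Module.End.mem_maxGenEigenspace] at hv
  obtain ⟨k, hk⟩ := hv
  have := key k v (by simpa [Algebra.algebraMap_eq_smul_one] using hk)
  rw [hφ] at this
  exact sub_eq_zero.1 this

/-- If the diagonal blocks of powers of `T` and the block cycles of `T` are as in a monomial
block matrix, then `T` is similar to the block diagonal matrix of `h a`-th roots. -/
theorem exists_blockDiagonalization (T : Matrix (α × ι) (α × ι) ℂ) (D : α → Matrix ι ι ℂ)
    (h ν : α → ℕ) (hν : ∀ a, ν a < h a) (hT : ∀ κ ∈ eigs T, ‖κ‖ = 1)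
    (hD : ∀ a, ∀ κ ∈ eigs (D a), ‖κ‖ = 1)
    (hpow : ∀ a v i, (T ^ h a).mulVec v (a, i) = (D a).mulVec (fun j ↦ v (a, j)) i)
    (hcyc : ∀ b n, n < h b → ∃ a k, ν a = n ∧ h a = h b ∧
      ∀ v, (∀ i, (T ^ k).mulVec v (a, i) = 0) → ∀ i, v (b, i) = 0) :
    ∃ (P : GL (α × ι) ℂ) (R : α → Matrix ι ι ℂ),
      (∀ a, R a ^ h a = D a ∧ ∀ κ ∈ eigs (R a), ⌊h a * mu κ⌋ = (ν a : ℤ)) ∧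
      ((P⁻¹ : GL (α × ι) ℂ) : Matrix (α × ι) (α × ι) ℂ) * T * (P : Matrix _ _ ℂ) =
        Matrix.of (fun x y ↦ if x.1 = y.1 then R x.1 x.2 y.2 else 0) ∧
      ∀ κ, ∀ v ∈ Module.End.maxGenEigenspace T.toLin' κ, ∀ a i,
        ((P⁻¹ : GL (α × ι) ℂ) : Matrix (α × ι) (α × ι) ℂ).mulVec v (a, i) =
          if ⌊h a * mu κ⌋ = (ν a : ℤ) then v (a, i) else 0 := by
  classical
  have hh : ∀ a, 0 < h a := fun a ↦ (Nat.zero_le _).trans_lt (hν a)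
  choose R hR1 hR2 using fun a ↦ exists_root_of_sector (D a) (hD a) (hν a)
  have hR3 : ∀ a, ∀ κ ∈ eigs (R a), ‖κ‖ = 1 ∧ ⌊h a * mu κ⌋ = (ν a : ℤ) := fun a κ hκ ↦
    ⟨norm_eq_one_of_norm_pow (hh a) (hD a _ (hR1 a ▸ eigs_pow_mem hκ (h a))), hR2 a κ hκ⟩
  obtain ⟨p, hp1, hp2, hp3⟩ := exists_genEigenspace_projections T.toLin'
  let π : α → (α × ι → ℂ) →ₗ[ℂ] ι → ℂ := fun a ↦ LinearMap.funLeft ℂ ℂ (fun i ↦ (a, i))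
  -- `Q` will be `P⁻¹`: in block `a` it keeps only the part of a vector whose eigenvalues lie in
  -- sector `ν a`.
  let Q : Module.End ℂ (α × ι → ℂ) := LinearMap.pi fun x ↦
    ∑ κ ∈ eigs T with ⌊h x.1 * mu κ⌋ = (ν x.1 : ℤ), LinearMap.proj x ∘ₗ p κ
  have hQ : ∀ κ, ∀ v ∈ Module.End.maxGenEigenspace T.toLin' κ, ∀ a i,
      Q v (a, i) = if ⌊h a * mu κ⌋ = (ν a : ℤ) then v (a, i) else 0 := by
    intro κ v hv a i
    by_cases hv0 : v = 0
    · simp [hv0]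
    have hκ := mem_eigs_of_mem_maxGenEigenspace hv0 hv
    simp only [Q, LinearMap.pi_apply, LinearMap.sum_apply, LinearMap.comp_apply,
      LinearMap.proj_apply]
    have : ∀ l ∈ (eigs T).filter (fun l ↦ ⌊h a * mu l⌋ = (ν a : ℤ)), p l v (a, i) =
        if l = κ then v (a, i) else 0 := by
      intro l _
      split_ifs with hl
      · rw [hl, hp2 κ v hv]
      · rw [hp3 κ l (Ne.symm hl) v hv]; rfl
    rw [Finset.sum_congr rfl this, Finset.sum_ite_eq']
    simp [hκ]
  let B : Matrix (α × ι) (α × ι) ℂ :=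
    Matrix.of (fun x y ↦ if x.1 = y.1 then R x.1 x.2 y.2 else 0)
  have hB : ∀ v a i, B.mulVec v (a, i) = (R a).mulVec (fun j ↦ v (a, j)) i := by
    intro v a i
    simp [B, Matrix.mulVec, dotProduct, Fintype.sum_prod_type, ite_mul]
  have hTV : ∀ κ, ∀ v ∈ Module.End.maxGenEigenspace T.toLin' κ,
      T.mulVec v ∈ Module.End.maxGenEigenspace T.toLin' κ := fun κ v hv ↦ by
    simpa using Module.End.mapsTo_maxGenEigenspace_of_comm (Commute.refl T.toLin') κ hv
  have hK : ∀ κ, ∀ v ∈ Module.End.maxGenEigenspace T.toLin' κ, ∀ a,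
      ⌊h a * mu κ⌋ = (ν a : ℤ) → ∀ i, T.mulVec v (a, i) = (R a).mulVec (fun j ↦ v (a, j)) i := by
    intro κ v hv a ha i
    by_cases hv0 : v = 0
    · subst hv0
      rw [Matrix.mulVec_zero]
      exact (congrFun (Matrix.mulVec_zero (R a)) i).symm
    have hκ := hT κ (mem_eigs_of_mem_maxGenEigenspace hv0 hv)
    have := intertwine_of_intertwine_pow T.toLin' (R a) (hν a) (hR3 a) hκ ha (π a) (fun u ↦ by
      ext j
      rw [hR1, ← Matrix.toLin'_pow]
      exact hpow a u j) hv
    exact congrFun this i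
  have hQT : ∀ v, Q (T.mulVec v) = B.mulVec (Q v) := by
    have : Q ∘ₗ T.toLin' = B.toLin' ∘ₗ Q := by
      refine ext_maxGenEigenspace T.toLin' fun κ v hv ↦ ?_
      ext ⟨a, i⟩
      simp only [LinearMap.comp_apply, Matrix.toLin'_apply]
      rw [hQ κ _ (hTV κ v hv), hB]
      simp only [hQ κ v hv]
      split_ifs with ha
      · exact hK κ v hv a ha i
      · exact (congrFun (Matrix.mulVec_zero (R a)) i).symm
    intro v
    simpa using LinearMap.congr_fun this v
  -- The kernel is stable under `T` because `Q T = B Q`, so if nonzero it contains an eigenvector of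
  -- `T`. On the cycle of any `b`, the index `a` with `ν a` equal to the sector of `κ` has a block
  -- that `Q` keeps, hence zero; `hcyc` takes this back to `b`.
  have hker : LinearMap.ker Q = ⊥ := by
    by_contra hne
    obtain ⟨κ, v, hvK, hv0, hv⟩ := exists_eigenvector_of_mapsTo T.toLin' _ hne (by
      intro u hu
      rw [LinearMap.mem_ker] at hu ⊢
      rw [Matrix.toLin'_apply, hQT, hu, Matrix.mulVec_zero])
    rw [Matrix.toLin'_apply] at hv
    have hvE : v ∈ Module.End.maxGenEigenspace T.toLin' κ :=
      Module.End.eigenspace_le_maxGenEigenspace (Module.End.mem_eigenspace_iff.2 (by simpa using hv))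
    apply hv0
    ext ⟨b, i⟩
    obtain ⟨n, hn, hκn⟩ := exists_floor_mu (hh b) κ
    obtain ⟨a, k, ha, hab, hk⟩ := hcyc b n hn
    refine hk v (fun j ↦ ?_) i
    have h1 := hQ κ v hvE a j
    rw [if_pos (by rw [hab, hκn, ha]), LinearMap.mem_ker.1 hvK] at h1
    rw [pow_mulVec_of_eigenvector hv, Pi.smul_apply, ← h1]
    simp
  let M : Matrix (α × ι) (α × ι) ℂ := LinearMap.toMatrix' Q
  have hM : IsUnit M := by
    rw [← Matrix.mulVec_injective_iff_isUnit]
    intro u v huv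
    simp only [M, LinearMap.toMatrix'_mulVec] at huv
    exact LinearMap.ker_eq_bot.1 hker huv
  obtain ⟨U, hU⟩ := hM
  refine ⟨U⁻¹, R, fun a ↦ ⟨hR1 a, hR2 a⟩, ?_, fun κ v hv a i ↦ ?_⟩
  · have h1 : M * T = B * M := by
      apply Matrix.toLin'.injective
      ext1 v
      simp only [Matrix.toLin'_mul]
      ext1
      simp only [LinearMap.comp_apply, Matrix.toLin'_apply, M, LinearMap.toMatrix'_mulVec]
      rw [hQT]
    rw [inv_inv, hU, h1, ← hU, mul_assoc]
    simp [B]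
  · rw [inv_inv, hU, LinearMap.toMatrix'_mulVec, hQ κ v hv]

end Blocks

/-! ### Scalar functions of controlled growth -/

section Tame

/-- Holomorphic functions on `ℍ` of at most exponential growth on vertical strips. -/
structure IsTame (f : ℍ → ℂ) : Prop where
  holo : DifferentiableOn ℂ (f ∘ ofComplex) {z : ℂ | 0 < z.im}
  growth : ∀ B : ℝ, ∃ C Y : ℝ, ∀ τ : ℍ, |τ.re| ≤ B → Y < τ.im → ‖f τ‖ ≤ Real.exp (C * τ.im)

theorem isTame_const (c : ℂ) : IsTame fun _ ↦ c where
  holo := differentiableOn_const c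
  growth B := ⟨‖c‖, 1, fun τ _ hτ ↦ by
    have h1 := Real.add_one_le_exp (‖c‖ * τ.im)
    nlinarith [norm_nonneg c]⟩

theorem IsTame.add {f g : ℍ → ℂ} (hf : IsTame f) (hg : IsTame g) : IsTame fun τ ↦ f τ + g τ where
  holo := hf.holo.add hg.holo
  growth B := by
    obtain ⟨C, Y, h⟩ := hf.growth B
    obtain ⟨C', Y', h'⟩ := hg.growth B
    -- The extra `1` absorbs the factor two of the sum, since `2 ≤ exp (Im τ)` for `Im τ > 1`.
    refine ⟨max C C' + 1, max (max Y Y') 1, fun τ hB hτ ↦ ?_⟩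
    simp only [max_lt_iff] at hτ
    obtain ⟨⟨h1, h2⟩, h3⟩ := hτ
    have e1 : Real.exp (C * τ.im) ≤ Real.exp (max C C' * τ.im) :=
      Real.exp_le_exp.2 (mul_le_mul_of_nonneg_right (le_max_left _ _) τ.im_pos.le)
    have e2 : Real.exp (C' * τ.im) ≤ Real.exp (max C C' * τ.im) :=
      Real.exp_le_exp.2 (mul_le_mul_of_nonneg_right (le_max_right _ _) τ.im_pos.le)
    have e3 : (2 : ℝ) ≤ Real.exp τ.im := by linarith [Real.add_one_le_exp τ.im]
    rw [add_mul, one_mul, Real.exp_add]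
    have := norm_add_le (f τ) (g τ)
    have e4 := Real.exp_pos (max C C' * τ.im)
    nlinarith [h τ hB h1, h' τ hB h2]

theorem IsTame.mul {f g : ℍ → ℂ} (hf : IsTame f) (hg : IsTame g) : IsTame fun τ ↦ f τ * g τ where
  holo := hf.holo.mul hg.holo
  growth B := by
    obtain ⟨C, Y, h⟩ := hf.growth B
    obtain ⟨C', Y', h'⟩ := hg.growth B
    refine ⟨C + C', max Y Y', fun τ hB hτ ↦ ?_⟩
    simp only [max_lt_iff] at hτ
    rw [norm_mul, add_mul, Real.exp_add]
    exact mul_le_mul (h τ hB hτ.1) (h' τ hB hτ.2) (norm_nonneg _) (Real.exp_pos _).le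

theorem IsTame.const_mul {f : ℍ → ℂ} (hf : IsTame f) (c : ℂ) : IsTame fun τ ↦ c * f τ :=
  (isTame_const c).mul hf

theorem IsTame.sub {f g : ℍ → ℂ} (hf : IsTame f) (hg : IsTame g) : IsTame fun τ ↦ f τ - g τ := by
  simpa [sub_eq_add_neg] using hf.add (hg.const_mul (-1))

theorem IsTame.pow {f : ℍ → ℂ} (hf : IsTame f) (n : ℕ) : IsTame fun τ ↦ f τ ^ n := by
  induction n with
  | zero => simpa using isTame_const 1
  | succ n ih => simpa [pow_succ] using ih.mul hf

theorem isTame_sum {α : Type*} (s : Finset α) {f : α → ℍ → ℂ} (h : ∀ a ∈ s, IsTame (f a)) :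
    IsTame fun τ ↦ ∑ a ∈ s, f a τ := by
  classical
  induction s using Finset.induction_on with
  | empty => simpa using isTame_const 0
  | insert a s ha ih =>
    simp only [Finset.sum_insert ha]
    exact (h a (by simp)).add (ih fun b hb ↦ h b (by simp [hb]))

theorem isTame_coe : IsTame fun τ ↦ (τ : ℂ) where
  holo := differentiableOn_id.congr fun z hz ↦ by
    simp [ofComplex_apply_of_im_pos hz]
  growth B := ⟨|B| + 1, 1, fun τ hB hτ ↦ by
    have h1 := Real.add_one_le_exp ((|B| + 1) * τ.im)
    have h2 := Complex.norm_le_abs_re_add_abs_im (τ : ℂ)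
    simp only [coe_re, coe_im, abs_of_pos τ.im_pos] at h2
    nlinarith [abs_nonneg B, le_abs_self B]⟩

theorem isTame_logq (w : ℝ) : IsTame (logq w) := by
  have := isTame_coe.const_mul (2 * Real.pi * Complex.I / w)
  convert this using 2
  rw [logq]; ring

theorem isTame_exp_logq (w : ℝ) (c : ℝ) : IsTame fun τ ↦ Complex.exp (c * logq w τ) where
  holo := by
    have h1 : DifferentiableOn ℂ (logq w ∘ ofComplex) {z : ℂ | 0 < z.im} := (isTame_logq w).holo
    exact (h1.const_mul (c : ℂ)).cexp
  growth B := by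
    refine ⟨|c * (2 * Real.pi / w)|, 0, fun τ _ _ ↦ ?_⟩
    have : (c * logq w τ).re = -(c * (2 * Real.pi / w)) * τ.im := by
      rw [logq, show (c : ℂ) * (2 * Real.pi * Complex.I * τ / w) =
        ((c * (2 * Real.pi / w) : ℝ) : ℂ) * (Complex.I * τ) by push_cast; ring,
        Complex.re_ofReal_mul]
      simp
    rw [Complex.norm_exp, this]
    exact Real.exp_le_exp.2 (mul_le_mul_of_nonneg_right (neg_le_abs _) τ.im_pos.le)

theorem ofComplex_add_ofReal (w : ℝ) {z : ℂ} (hz : 0 < z.im) :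
    ofComplex (z + w) = w +ᵥ ofComplex z := by
  have hz' : 0 < (z + w).im := by simpa using hz
  ext
  rw [coe_vadd]
  simp [ofComplex_apply_of_im_pos hz, ofComplex_apply_of_im_pos hz', add_comm]

theorem IsTame.comp_vadd {f : ℍ → ℂ} (hf : IsTame f) (w : ℝ) : IsTame fun τ ↦ f (w +ᵥ τ) where
  holo := by
    have h1 : DifferentiableOn ℂ (fun z : ℂ ↦ (f ∘ ofComplex) (z + w)) {z : ℂ | 0 < z.im} :=
      hf.holo.comp (by fun_prop) (fun z hz ↦ by simpa using hz)
    exact h1.congr fun z hz ↦ by simp [ofComplex_add_ofReal w hz]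
  growth B := by
    obtain ⟨C, Y, h⟩ := hf.growth (B + |w|)
    refine ⟨C, Y, fun τ hB hτ ↦ ?_⟩
    have := h (w +ᵥ τ) (by
      rw [vadd_re]
      linarith [abs_add_le w τ.re]) (by simpa using hτ)
    simpa using this

end Tame

/-! ### Laurent series in the local parameter -/

section Laurent

theorem logq_vadd {w : ℝ} (hw : 0 < w) (τ : ℍ) :
    logq w (w +ᵥ τ) = logq w τ + 2 * Real.pi * Complex.I := by
  have : (w : ℂ) ≠ 0 := by exact_mod_cast hw.ne'
  rw [logq, logq, coe_vadd]
  field_simp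
  ring

theorem exp_int_mul_logq_vadd {w : ℝ} (hw : 0 < w) (n : ℤ) (τ : ℍ) :
    Complex.exp (n * logq w (w +ᵥ τ)) = Complex.exp (n * logq w τ) := by
  rw [logq_vadd hw, mul_add, Complex.exp_add, Complex.exp_int_mul_two_pi_mul_I, mul_one]

theorem exp_mu_mul_logq_vadd {w : ℝ} (hw : 0 < w) {κ : ℂ} (hκ : ‖κ‖ = 1) (τ : ℍ) :
    Complex.exp (mu κ * logq w (w +ᵥ τ)) = κ * Complex.exp (mu κ * logq w τ) := by
  rw [logq_vadd hw, mul_add, Complex.exp_add, mul_comm (mu κ : ℂ) (2 * _ * _), exp_mu hκ, mul_comm]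

theorem exp_nat_mul_logq (w : ℝ) (n : ℕ) (τ : ℍ) :
    Complex.exp (n * logq w τ) = Function.Periodic.qParam w τ ^ n := by
  rw [Complex.exp_nat_mul]; rfl

/-- Outside the upper half-plane `ofComplex` takes one default value, so periodicity holds there
trivially. -/
theorem periodic_comp_ofComplex {w : ℝ} {f : ℍ → ℂ} (hf : ∀ τ, f (w +ᵥ τ) = f τ) :
    Function.Periodic (f ∘ ofComplex) w := by
  intro z
  by_cases hz : 0 < z.im
  · simp [ofComplex_add_ofReal w hz, hf]
  · have hz' : ¬ 0 < (z + w).im := by simpa using hz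
    simp [ofComplex_apply_of_im_nonpos (not_lt.1 hz), ofComplex_apply_of_im_nonpos (not_lt.1 hz')]

/-- Multiplication by `q^{-M}` turns the Laurent series into a power series, to which the theory of
`q`-expansions applies. -/
theorem laurent_hasSum_iff {w : ℝ} {a : ℤ → ℂ} {M : ℤ} (ha : ∀ n < M, a n = 0) (τ : ℍ) (s : ℂ) :
    HasSum (fun n : ℤ ↦ Complex.exp (n * logq w τ) * a n) s ↔
      HasSum (fun k : ℕ ↦ a (M + k) • Function.Periodic.qParam w τ ^ k)
        (Complex.exp ((-M : ℤ) * logq w τ) * s) := by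
  have hinj : Function.Injective fun k : ℕ ↦ M + (k : ℤ) := fun x y h ↦ by
    simpa using h
  rw [← hinj.hasSum_iff (by
    intro n hn
    rw [ha n, mul_zero]
    by_contra hlt
    exact hn ⟨(n - M).toNat, by simp only [Int.ofNat_toNat]; omega⟩)]
  rw [← hasSum_mul_left_iff (Complex.exp_ne_zero ((-M : ℤ) * logq w τ))]
  refine iff_of_eq (congrArg (HasSum · _) ?_)
  funext k
  simp only [Function.comp_apply, smul_eq_mul]
  rw [← exp_nat_mul_logq, ← mul_assoc, ← Complex.exp_add, mul_comm]
  congr 2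
  push_cast; ring

theorem laurent_unique {w : ℝ} (hw : 0 < w) {a : ℤ → ℂ} {M : ℤ} (ha : ∀ n < M, a n = 0)
    (h : ∀ τ : ℍ, HasSum (fun n : ℤ ↦ Complex.exp (n * logq w τ) * a n) 0) (n : ℤ) : a n = 0 := by
  by_cases hn : n < M
  · exact ha n hn
  have h1 : ∀ τ : ℍ, HasSum (fun k : ℕ ↦ a (M + k) • Function.Periodic.qParam w τ ^ k)
      ((0 : ℍ → ℂ) τ) := fun τ ↦ by
    have := (laurent_hasSum_iff ha τ 0).1 (h τ)
    simpa using this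
  have han := analyticAt_cuspFunction_zero hw
    (periodic_comp_ofComplex (f := (0 : ℍ → ℂ)) fun τ ↦ rfl)
    (UpperHalfPlane.mdifferentiable_iff.2 (isTame_const 0).holo)
    (isBoundedAtImInfty_of_hasSum_qExpansion hw h1)
  -- The zero function has both the shifted `a` and zero as power series at `q = 0`.
  have h2 := (hasFPowerSeriesOnBall_cuspFunction hw han h1).hasFPowerSeriesAt
  have h3 := (hasFPowerSeriesOnBall_cuspFunction (c := 0) hw han fun τ ↦ by
    simp).hasFPowerSeriesAt
  have h4 := congrArg (FormalMultilinearSeries.coeff · (n - M).toNat)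
    (h2.eq_formalMultilinearSeries h3)
  have h5 : FormalMultilinearSeries.coeff (0 : FormalMultilinearSeries ℂ ℂ ℂ) (n - M).toNat = 0 := rfl
  simpa [not_lt.1 hn, h5] using h4

/-- Exponential growth is a pole of finite order in `q`: for large `K` the function `q^K f` is
bounded near the cusp and has a `q`-expansion. -/
theorem exists_laurent {w : ℝ} (hw : 0 < w) {f : ℍ → ℂ} (hf : IsTame f)
    (hper : ∀ τ, f (w +ᵥ τ) = f τ) : ∃ (a : ℤ → ℂ) (M : ℤ), (∀ n < M, a n = 0) ∧
      ∀ τ : ℍ, HasSum (fun n : ℤ ↦ Complex.exp (n * logq w τ) * a n) (f τ) := by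
  obtain ⟨C, Y, hC⟩ := hf.growth w
  obtain ⟨K, hK⟩ := exists_nat_ge (C * w / (2 * Real.pi))
  let F : ℍ → ℂ := fun τ ↦ Complex.exp (((K : ℤ) : ℝ) * logq w τ) * f τ
  have hF : IsTame F := (isTame_exp_logq w _).mul hf
  have hFper : ∀ τ, F (w +ᵥ τ) = F τ := fun τ ↦ by
    have := exp_int_mul_logq_vadd hw K τ
    simp only [F, hper]
    push_cast at this ⊢
    rw [this]
  have hbd : IsBoundedAtImInfty F := by
    rw [isBoundedAtImInfty_iff]
    refine ⟨1, Y + 1, fun τ hτ ↦ ?_⟩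
    -- Growth is controlled only on strips; a period moves `τ` into the strip `|Re| ≤ w` without
    -- changing `f`.
    let n := ⌊τ.re / w⌋
    let σ : ℍ := (-(n * w)) +ᵥ τ
    have h1 : f τ = f σ := by
      have h2 := (periodic_comp_ofComplex hper).sub_int_mul_eq (x := (τ : ℂ)) n
      have h3 : (τ : ℂ) - n * w = (σ : ℂ) := by simp only [σ, coe_vadd]; push_cast; ring
      rw [h3] at h2
      simpa using h2.symm
    have h4 : |σ.re| ≤ w := by
      have h5 := Int.floor_le (τ.re / w)
      have h6 := Int.lt_floor_add_one (τ.re / w)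
      rw [le_div_iff₀ hw] at h5
      rw [div_lt_iff₀ hw] at h6
      have h7 : σ.re = τ.re - n * w := by simp only [σ, vadd_re]; ring
      rw [h7, abs_le]
      constructor <;> simp only [n] <;> nlinarith
    have h5 : σ.im = τ.im := vadd_im _ _
    have h6 := hC σ h4 (by linarith)
    rw [← h1, h5] at h6
    have h7 : ‖Complex.exp (((K : ℤ) : ℝ) * logq w τ)‖ = Real.exp (-(K * (2 * Real.pi / w)) * τ.im) := by
      rw [Complex.norm_exp, logq, show (((K : ℤ) : ℝ) : ℂ) * (2 * Real.pi * Complex.I * τ / w) =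
        ((K * (2 * Real.pi / w) : ℝ) : ℂ) * (Complex.I * τ) by push_cast; ring,
        Complex.re_ofReal_mul]
      simp
    have h8 : C ≤ K * (2 * Real.pi / w) := by
      rw [div_le_iff₀ (by positivity)] at hK
      rw [mul_div_assoc', le_div_iff₀ hw]
      linarith
    simp only [F]
    rw [norm_mul, h7]
    calc _ ≤ Real.exp (-(K * (2 * Real.pi / w)) * τ.im) * Real.exp (C * τ.im) :=
          mul_le_mul_of_nonneg_left h6 (Real.exp_pos _).le
      _ = Real.exp ((C - K * (2 * Real.pi / w)) * τ.im) := by rw [← Real.exp_add]; ring_nf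
      _ ≤ 1 := Real.exp_le_one_iff.2 (mul_nonpos_of_nonpos_of_nonneg (by linarith) τ.im_pos.le)
  have hsum := fun τ ↦ hasSum_qExpansion hw (periodic_comp_ofComplex hFper)
    (UpperHalfPlane.mdifferentiable_iff.2 hF.holo) hbd τ
  let a : ℤ → ℂ := fun n ↦ if n < -K then 0 else (qExpansion w F).coeff (n + K).toNat
  have ha : ∀ n < (-K : ℤ), a n = 0 := fun n hn ↦ if_pos hn
  refine ⟨a, -K, ha, fun τ ↦ ?_⟩
  rw [laurent_hasSum_iff ha]
  have h1 : ∀ k : ℕ, a (-K + k) = (qExpansion w F).coeff k := fun k ↦ by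
    simp [a]
  simp only [h1]
  simpa [F] using hsum τ

end Laurent

/-! ### Expansions with logarithms -/

section LogSum

/-- The translation operator on functions on `ℍ`. -/
def translOp (w : ℝ) : Module.End ℂ (ℍ → ℂ) := LinearMap.funLeft ℂ ℂ fun τ ↦ w +ᵥ τ

theorem translOp_sub_apply (w : ℝ) (κ : ℂ) (f : ℍ → ℂ) (τ : ℍ) :
    (translOp w - algebraMap ℂ (Module.End ℂ (ℍ → ℂ)) κ) f τ = f (w +ᵥ τ) - κ * f τ := by
  simp [translOp, LinearMap.funLeft_apply, Module.algebraMap_end_apply]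

/-- The function `∑_{j < k} (log q)ʲ q^{μ(κ)} g_j`. -/
def logSum (w : ℝ) (κ : ℂ) (k : ℕ) (g : ℕ → ℍ → ℂ) (τ : ℍ) : ℂ :=
  ∑ j ∈ Finset.range k, logq w τ ^ j * Complex.exp (mu κ * logq w τ) * g j τ

/-- Translation adds `2πi` to `log q` and multiplies `q^{μ(κ)}` by `κ`. By the binomial theorem the
top powers cancel, so the degree in `log q` drops. The coefficients are explicit because
`exists_logSum` has to invert the leading one. -/
theorem translOp_sub_logSum {w : ℝ} (hw : 0 < w) {κ : ℂ} (hκ : ‖κ‖ = 1) (k : ℕ) (g : ℕ → ℍ → ℂ)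
    (hg : ∀ j τ, g j (w +ᵥ τ) = g j τ) :
    (translOp w - algebraMap ℂ (Module.End ℂ (ℍ → ℂ)) κ) (logSum w κ k g) =
      logSum w κ (k - 1) fun m τ ↦ ∑ j ∈ Finset.Ioo m k,
        κ * ((2 * Real.pi * Complex.I) ^ (j - m) * (j.choose m)) * g j τ := by
  funext τ
  rw [translOp_sub_apply]
  simp only [logSum, Finset.mul_sum, exp_mu_mul_logq_vadd hw hκ, hg, ← Finset.sum_sub_distrib]
  simp only [logq_vadd hw]
  have h1 : ∀ j ∈ Finset.range k, (logq w τ + 2 * Real.pi * Complex.I) ^ j *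
      (κ * Complex.exp (mu κ * logq w τ)) * g j τ -
      κ * (logq w τ ^ j * Complex.exp (mu κ * logq w τ) * g j τ) =
      ∑ m ∈ Finset.range j, logq w τ ^ m * Complex.exp (mu κ * logq w τ) *
        (κ * ((2 * Real.pi * Complex.I) ^ (j - m) * (j.choose m)) * g j τ) := by
    intro j _
    rw [add_pow, Finset.sum_range_succ]
    simp only [tsub_self, pow_zero, Nat.choose_self, Nat.cast_one, mul_one]
    have e : ∀ A : ℂ, (A + logq w τ ^ j) * (κ * Complex.exp (mu κ * logq w τ)) * g j τ -
        κ * (logq w τ ^ j * Complex.exp (mu κ * logq w τ) * g j τ) =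
        A * (κ * Complex.exp (mu κ * logq w τ) * g j τ) := fun A ↦ by ring
    rw [e, Finset.sum_mul]
    exact Finset.sum_congr rfl fun m _ ↦ by ring
  rw [Finset.sum_congr rfl h1, Finset.sum_sigma', Finset.sum_sigma']
  refine Finset.sum_bij' (fun x _ ↦ ⟨x.2, x.1⟩) (fun x _ ↦ ⟨x.2, x.1⟩) ?_ ?_ ?_ ?_ ?_
  · rintro ⟨j, m⟩ h; simp at h ⊢; omega
  · rintro ⟨m, j⟩ h; simp at h ⊢; omega
  · rintro ⟨j, m⟩ _; rfl
  · rintro ⟨m, j⟩ _; rfl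
  · rintro ⟨j, m⟩ _; rfl

theorem translOp_sub_pow_logSum {w : ℝ} (hw : 0 < w) {κ : ℂ} (hκ : ‖κ‖ = 1) (k : ℕ) :
    ∀ g : ℕ → ℍ → ℂ, (∀ j τ, g j (w +ᵥ τ) = g j τ) →
    ((translOp w - algebraMap ℂ (Module.End ℂ (ℍ → ℂ)) κ) ^ k) (logSum w κ k g) = 0 := by
  induction k with
  | zero => intro g _; funext τ; simp [logSum]
  | succ k ih =>
    intro g hg
    rw [pow_succ, Module.End.mul_apply, translOp_sub_logSum hw hκ _ g hg, add_tsub_cancel_right]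
    exact ih _ fun j τ ↦ by simp only [hg]

/-- Along `τ + n w` the coefficients stay fixed while `log q` takes infinitely many values, so the
polynomial in `log q` is zero. -/
theorem logSum_eq_zero {w : ℝ} (hw : 0 < w) {κ : ℂ} {k : ℕ} {g : ℕ → ℍ → ℂ}
    (hg : ∀ j τ, g j (w +ᵥ τ) = g j τ) (h : ∀ τ, logSum w κ k g τ = 0) {j : ℕ} (hj : j < k)
    (τ : ℍ) : g j τ = 0 := by
  have hit : ∀ n : ℕ, ∃ σ : ℍ, logq w σ = logq w τ + n * (2 * Real.pi * Complex.I) ∧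
      ∀ j, g j σ = g j τ := by
    intro n
    induction n with
    | zero => exact ⟨τ, by simp, fun _ ↦ rfl⟩
    | succ n ih =>
      obtain ⟨σ, h1, h2⟩ := ih
      refine ⟨w +ᵥ σ, ?_, fun j ↦ by rw [hg, h2]⟩
      rw [logq_vadd hw, h1]; push_cast; ring
  let p : Polynomial ℂ := ∑ j ∈ Finset.range k, Polynomial.monomial j (g j τ)
  have hp : p = 0 := by
    refine Polynomial.eq_zero_of_infinite_isRoot p (Set.infinite_of_injective_forall_mem
      (f := fun n : ℕ ↦ logq w τ + n * (2 * Real.pi * Complex.I)) ?_ fun n ↦ ?_)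
    · intro a b hab
      have := mul_right_cancel₀ Complex.two_pi_I_ne_zero (add_left_cancel hab)
      exact_mod_cast this
    · obtain ⟨σ, h1, h2⟩ := hit n
      have h3 := h σ
      rw [logSum] at h3
      have h4 : Complex.exp (mu κ * logq w σ) * p.eval (logq w σ) = 0 := by
        rw [← h3]
        simp only [p, Polynomial.eval_finsetSum, Polynomial.eval_monomial, Finset.mul_sum, h2]
        exact Finset.sum_congr rfl fun _ _ ↦ by ring
      simp only [Set.mem_ofPred_eq, Polynomial.IsRoot, ← h1]
      exact (mul_eq_zero.1 h4).resolve_left (Complex.exp_ne_zero _)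
  have h5 := congrArg (Polynomial.coeff · j) hp
  simpa [p, Polynomial.finsetSum_coeff, Polynomial.coeff_monomial, hj] using h5

/-- The summands lie in generalized eigenspaces of translation for distinct `κ`, and these are
independent even in an infinite-dimensional space. -/
theorem sum_logSum_eq_zero {w : ℝ} (hw : 0 < w) {S : Finset ℂ} (hS : ∀ κ ∈ S, ‖κ‖ = 1) {k : ℕ}
    {g : ℂ → ℕ → ℍ → ℂ} (hg : ∀ κ j τ, g κ j (w +ᵥ τ) = g κ j τ)
    (h : ∀ τ, ∑ κ ∈ S, logSum w κ k (g κ) τ = 0) {κ : ℂ} (hκ : κ ∈ S) {j : ℕ} (hj : j < k)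
    (τ : ℍ) : g κ j τ = 0 := by
  have hind := (translOp w).independent_maxGenEigenspace
  rw [iSupIndep_iff_finsetSum_eq_zero_imp_eq_zero] at hind
  have h1 := hind S (fun κ ↦ logSum w κ k (g κ)) (fun κ hκ ↦ by
    rw [Module.End.mem_maxGenEigenspace]
    refine ⟨k, ?_⟩
    have := translOp_sub_pow_logSum hw (hS κ hκ) k (g κ) (hg κ)
    rwa [Algebra.algebraMap_eq_smul_one] at this) (by
    funext τ; simpa using h τ) κ hκ
  exact logSum_eq_zero hw (hg κ) (fun τ ↦ congrFun h1 τ) hj τ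

/-- A tame function killed by a power of `translOp w - κ` is a polynomial in `log q` with tame
periodic coefficients, times `q^{μ(κ)}`. -/
theorem exists_logSum {w : ℝ} (hw : 0 < w) {κ : ℂ} (hκ : ‖κ‖ = 1) (k : ℕ) :
    ∀ f : ℍ → ℂ, IsTame f →
    ((translOp w - algebraMap ℂ (Module.End ℂ (ℍ → ℂ)) κ) ^ k) f = 0 →
    ∃ g : ℕ → ℍ → ℂ, (∀ j, IsTame (g j)) ∧ (∀ j τ, g j (w +ᵥ τ) = g j τ) ∧
      f = logSum w κ k g := by
  have hκ0 : κ ≠ 0 := by rintro rfl; simp at hκ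
  induction k with
  | zero =>
    intro f _ h
    refine ⟨fun _ _ ↦ 0, fun _ ↦ isTame_const 0, fun _ _ ↦ rfl, ?_⟩
    simp only [pow_zero, Module.End.one_apply] at h
    funext τ; simp [h, logSum]
  | succ k ih =>
    intro f hf h
    set D := translOp w - algebraMap ℂ (Module.End ℂ (ℍ → ℂ)) κ with hD
    -- For the first power, `q^{-μ(κ)} f` is periodic. Higher powers reduce to lower ones by
    -- removing the leading term.
    obtain _ | k := k
    · have h1 : ∀ τ, f (w +ᵥ τ) = κ * f τ := fun τ ↦ by
        have := congrFun h τ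
        rw [zero_add, pow_one, hD, translOp_sub_apply] at this
        exact sub_eq_zero.1 this
      refine ⟨fun _ τ ↦ Complex.exp (((-mu κ : ℝ) : ℂ) * logq w τ) * f τ, fun _ ↦
        (isTame_exp_logq w _).mul hf, fun _ τ ↦ ?_, ?_⟩
      · have h2 : ((-mu κ : ℝ) : ℂ) * logq w (w +ᵥ τ) = -(mu κ * logq w (w +ᵥ τ)) := by
          push_cast; ring
        have h3 : ((-mu κ : ℝ) : ℂ) * logq w τ = -(mu κ * logq w τ) := by
          push_cast; ring
        simp only []
        rw [h2, h3, Complex.exp_neg, Complex.exp_neg, exp_mu_mul_logq_vadd hw hκ, h1]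
        field_simp
      · funext τ
        simp only [logSum, zero_add, Finset.range_one, Finset.sum_singleton, pow_zero, one_mul]
        rw [← mul_assoc, ← Complex.exp_add]
        simp
    · have hDf : IsTame (D f) := by
        have := (hf.comp_vadd w).sub (hf.const_mul κ)
        convert this using 1
        funext τ; rw [hD, translOp_sub_apply]
      obtain ⟨g, hg1, hg2, hg3⟩ := ih (D f) hDf (by
        rw [← Module.End.mul_apply, ← pow_succ]; exact h)
      -- `c` is the factor by which `D` takes `(log q)^{k+1}` to its leading term in `(log q)^k`. So
      -- `D` maps the logarithmic sum of `G` to something with the same top term as `D f`, and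
      -- subtracting that sum from `f` lowers the degree.
      let c : ℂ := κ * ((2 * Real.pi * Complex.I) * (k + 1 : ℕ))
      have hc : c ≠ 0 := mul_ne_zero hκ0 (mul_ne_zero Complex.two_pi_I_ne_zero
        (by exact_mod_cast (Nat.succ_ne_zero k)))
      let G : ℕ → ℍ → ℂ := fun j τ ↦ if j = k + 1 then c⁻¹ * g k τ else 0
      have hG : ∀ j τ, G j (w +ᵥ τ) = G j τ := fun j τ ↦ by simp only [G, hg2]
      have hGs : ∀ τ, logSum w κ (k + 2) G τ =
          logq w τ ^ (k + 1) * Complex.exp (mu κ * logq w τ) * (c⁻¹ * g k τ) := fun τ ↦ by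
        rw [logSum, Finset.sum_range_succ, Finset.sum_eq_zero]
        · simp [G]
        · intro j hj
          have := Finset.mem_range.1 hj
          simp [G, this.ne]
      let f' : ℍ → ℂ := f - logSum w κ (k + 2) G
      have hf' : IsTame f' := by
        have := hf.sub ((((isTame_logq w).pow (k + 1)).mul (isTame_exp_logq w (mu κ))).mul
          ((hg1 k).const_mul c⁻¹))
        convert this using 1
        funext τ
        simp only [f', Pi.sub_apply, hGs]
      have hDf' : D f' = logSum w κ k fun m τ ↦ g m τ - ∑ j ∈ Finset.Ioo m (k + 2),
          κ * ((2 * Real.pi * Complex.I) ^ (j - m) * (j.choose m)) * G j τ := by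
        rw [map_sub, hg3, hD, translOp_sub_logSum hw hκ _ G hG]
        funext τ
        simp only [logSum, Pi.sub_apply]
        rw [show k + 2 - 1 = k + 1 by omega, ← Finset.sum_sub_distrib, Finset.sum_range_succ]
        simp only [← mul_sub]
        rw [add_eq_left]
        have h1 : Finset.Ioo k (k + 2) = {k + 1} := by ext; simp; omega
        rw [h1, Finset.sum_singleton]
        have h2 : κ * ((2 * Real.pi * Complex.I) ^ (k + 1 - k) * ((k + 1).choose k : ℕ)) = c := by
          simp [c]
        rw [h2]
        simp only [G, if_true]
        rw [mul_inv_cancel_left₀ hc, sub_self, mul_zero]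
      have hk : (D ^ (k + 1)) f' = 0 := by
        rw [pow_succ, Module.End.mul_apply, hDf']
        exact translOp_sub_pow_logSum hw hκ k _ fun j τ ↦ by simp only [hg2, hG]
      obtain ⟨g', hg1', hg2', hg3'⟩ := ih f' hf' hk
      refine ⟨fun j ↦ if j = k + 1 then fun τ ↦ c⁻¹ * g k τ else g' j, fun j ↦ ?_, fun j τ ↦ ?_, ?_⟩
      · beta_reduce
        split_ifs
        exacts [(hg1 k).const_mul _, hg1' j]
      · beta_reduce
        split_ifs
        exacts [by simp only [hg2], hg2' j τ]
      · funext τ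
        have h1 : f τ = f' τ + logSum w κ (k + 2) G τ := by simp [f']
        rw [h1, hGs, hg3', logSum, logSum, Finset.sum_range_succ _ (k + 1)]
        congr 1
        · refine Finset.sum_congr rfl fun j hj ↦ ?_
          rw [if_neg (Finset.mem_range.1 hj).ne]
        · simp

end LogSum

/-! ### Logarithmic Fourier expansions of scalar functions -/

section LogExpansion

/-- The family `c κ j n` gives an expansion `f = ∑_κ ∑_j (log q)ʲ q^{μ(κ)} ∑ₙ c κ j n qⁿ`. -/
def HasLogExpansion (w : ℝ) (f : ℍ → ℂ) (c : ℂ → ℕ → ℤ → ℂ) : Prop :=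
  ∃ (S : Finset ℂ) (J : ℕ), (∀ κ ∈ S, ‖κ‖ = 1) ∧ (∀ κ j n, c κ j n ≠ 0 → κ ∈ S ∧ j < J) ∧
    (∃ M : ℤ, ∀ κ j n, n < M → c κ j n = 0) ∧
    (∀ κ j (τ : ℍ), Summable fun n : ℤ ↦ Complex.exp (n * logq w τ) * c κ j n) ∧
    ∀ τ, f τ = ∑ κ ∈ S, logSum w κ J (fun j τ ↦ ∑' n : ℤ, Complex.exp (n * logq w τ) * c κ j n) τ

theorem sum_logSum_mono {w : ℝ} {c : ℂ → ℕ → ℤ → ℂ} {S S' : Finset ℂ} {J J' : ℕ}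
    (hc : ∀ κ j n, c κ j n ≠ 0 → κ ∈ S ∧ j < J) (hS : S ⊆ S') (hJ : J ≤ J') (τ : ℍ) :
    ∑ κ ∈ S, logSum w κ J (fun j τ ↦ ∑' n : ℤ, Complex.exp (n * logq w τ) * c κ j n) τ =
    ∑ κ ∈ S', logSum w κ J' (fun j τ ↦ ∑' n : ℤ, Complex.exp (n * logq w τ) * c κ j n) τ := by
  have h0 : ∀ κ j, ¬ (κ ∈ S ∧ j < J) →
      ∑' n : ℤ, Complex.exp (n * logq w τ) * c κ j n = 0 := by
    intro κ j h
    have : ∀ n, c κ j n = 0 := fun n ↦ by_contra fun hn ↦ h (hc κ j n hn)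
    simp [this]
  refine Finset.sum_subset_zero_on_sdiff hS (fun κ hκ ↦ ?_) fun κ hκ ↦ ?_
  · rw [logSum, Finset.sum_eq_zero]
    intro j _
    rw [h0 κ j fun h ↦ (Finset.mem_sdiff.1 hκ).2 h.1, mul_zero]
  · rw [logSum, logSum]
    refine Finset.sum_subset (by simpa using hJ) fun j _ hj ↦ ?_
    rw [h0 κ j fun h ↦ hj (Finset.mem_range.2 h.2), mul_zero]

/-- The index sets `S` and `J` may differ: both expansions are extended by zero to common ones and
subtracted. This matters because a regrouped expansion is not indexed by the eigenvalues of the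
lift's monodromy. -/
theorem HasLogExpansion.unique {w : ℝ} (hw : 0 < w) {f : ℍ → ℂ} {c c' : ℂ → ℕ → ℤ → ℂ}
    (h : HasLogExpansion w f c) (h' : HasLogExpansion w f c') : c = c' := by
  classical
  obtain ⟨S, J, hS, hc, ⟨M, hM⟩, hsum, hf⟩ := h
  obtain ⟨S', J', hS', hc', ⟨M', hM'⟩, hsum', hf'⟩ := h'
  have hper : ∀ (a : ℤ → ℂ) τ, ∑' n : ℤ, Complex.exp (n * logq w (w +ᵥ τ)) * a n =
      ∑' n : ℤ, Complex.exp (n * logq w τ) * a n := fun a τ ↦ by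
    simp only [exp_int_mul_logq_vadd hw]
  have hz : ∀ τ, ∑ κ ∈ S ∪ S', logSum w κ (max J J')
      (fun j τ ↦ ∑' n : ℤ, Complex.exp (n * logq w τ) * (c κ j n - c' κ j n)) τ = 0 := by
    intro τ
    have h1 := hf τ
    rw [hf', sum_logSum_mono hc Finset.subset_union_left (le_max_left J J'),
      sum_logSum_mono hc' Finset.subset_union_right (le_max_right J J'), eq_comm,
      ← sub_eq_zero, ← Finset.sum_sub_distrib] at h1
    rw [← h1]
    refine Finset.sum_congr rfl fun κ _ ↦ ?_
    rw [logSum, logSum, logSum, ← Finset.sum_sub_distrib]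
    refine Finset.sum_congr rfl fun j _ ↦ ?_
    simp only [mul_sub]
    rw [(hsum κ j τ).tsum_sub (hsum' κ j τ), mul_sub]
  funext κ j n
  by_cases hκ : κ ∈ S ∪ S' ∧ j < max J J'
  · have h1 := fun τ ↦ sum_logSum_eq_zero hw (S := S ∪ S') (k := max J J')
      (g := fun κ j τ ↦ ∑' n : ℤ, Complex.exp (n * logq w τ) * (c κ j n - c' κ j n))
      (fun κ hκ ↦ (Finset.mem_union.1 hκ).elim (hS κ) (hS' κ)) (fun κ j τ ↦ hper _ τ) hz
      hκ.1 hκ.2 τ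
    refine sub_eq_zero.1 (laurent_unique hw (M := min M M') (a := fun n ↦ c κ j n - c' κ j n)
      (fun n hn ↦ ?_) (fun τ ↦ ?_) n)
    · rw [hM κ j n (lt_of_lt_of_le hn (min_le_left _ _)),
        hM' κ j n (lt_of_lt_of_le hn (min_le_right _ _)), sub_self]
    · rw [← h1 τ]
      refine Summable.hasSum ?_
      simp only [mul_sub]
      exact (hsum κ j τ).sub (hsum' κ j τ)
  · have e1 : c κ j n = 0 := by_contra fun hne ↦
      hκ ⟨Finset.mem_union_left _ (hc κ j n hne).1, lt_max_of_lt_left (hc κ j n hne).2⟩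
    have e2 : c' κ j n = 0 := by_contra fun hne ↦
      hκ ⟨Finset.mem_union_right _ (hc' κ j n hne).1, lt_max_of_lt_right (hc' κ j n hne).2⟩
    rw [e1, e2]

theorem logq_natCast_mul {h : ℕ} (hh : 0 < h) (w : ℝ) (τ : ℍ) :
    logq (h * w) τ = (h : ℂ)⁻¹ * logq w τ := by
  have : (h : ℂ) ≠ 0 := by exact_mod_cast hh.ne'
  rw [logq, logq]
  push_cast
  field_simp

/-- An expansion in `q^{1/h}`, regrouped as an expansion in `q`. -/
theorem HasLogExpansion.regroup {w : ℝ} {h : ℕ} (hh : 0 < h) {f : ℍ → ℂ} {c : ℂ → ℕ → ℤ → ℂ}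
    (hf : HasLogExpansion (h * w) f c) :
    HasLogExpansion w f fun κ j n ↦ ((h : ℂ) ^ j)⁻¹ * c (κ ^ h) j (h * n + ⌊h * mu κ⌋) := by
  classical
  obtain ⟨S, J, hS, hc, ⟨M, hM⟩, hsum, hf⟩ := hf
  have : NeZero h := ⟨hh.ne'⟩
  have hh0 : (h : ℂ) ≠ 0 := by exact_mod_cast hh.ne'
  -- Pairs of an eigenvalue and a residue modulo `h` correspond to the `h`-th roots that index the
  -- new expansion.
  let b : ℂ × Fin h → ℂ := fun x ↦ branch h x.1 x.2
  have hb : Set.InjOn b (S ×ˢ (Finset.univ : Finset (Fin h)) : Finset (ℂ × Fin h)) := by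
    rintro ⟨l, r⟩ hl ⟨l', r'⟩ hl' hll
    simp only [Finset.coe_product, Finset.coe_univ, Set.mem_prod, Finset.mem_coe, Set.mem_univ,
      and_true] at hl hl'
    have e1 : l = l' := by
      rw [← branch_pow hh (hS l hl) r, ← branch_pow hh (hS l' hl') r']
      exact congrArg (· ^ h) hll
    have e2 : ((r : ℕ) : ℤ) = ((r' : ℕ) : ℤ) := by
      rw [← floor_mu_branch l r.2, ← floor_mu_branch l' r'.2]
      exact congrArg (fun z ↦ ⌊h * mu z⌋) hll
    simp only [Prod.mk.injEq]
    exact ⟨e1, Fin.ext (by exact_mod_cast e2)⟩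
  have hexp : ∀ (n : ℤ) (r : ℤ) τ, Complex.exp (((h * n + r : ℤ) : ℂ) * logq (h * w) τ) =
      Complex.exp (r * logq (h * w) τ) * Complex.exp (n * logq w τ) := by
    intro n r τ
    rw [← Complex.exp_add, logq_natCast_mul hh]
    congr 1
    push_cast
    field_simp
    ring
  have hsub : ∀ κ j τ (r : ℤ), Summable fun n : ℤ ↦
      Complex.exp (n * logq w τ) * c κ j (h * n + r) := by
    intro κ j τ r
    have hinj : Function.Injective fun n : ℤ ↦ h * n + r := fun x y hxy ↦ by
      simpa [hh.ne'] using hxy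
    have h1 := (hsum κ j τ).comp_injective hinj
    have h2 := h1.mul_left (Complex.exp (r * logq (h * w) τ))⁻¹
    refine h2.congr fun n ↦ ?_
    simp only [Function.comp_apply]
    rw [hexp, ← mul_assoc, ← mul_assoc, inv_mul_cancel₀ (Complex.exp_ne_zero _), one_mul]
  -- The `- 1` makes room for the shift `⌊h μ(κ)⌋`, which is less than `h`.
  refine ⟨(S ×ˢ Finset.univ).image b, J, ?_, ?_, ⟨M / h - 1, ?_⟩, ?_, ?_⟩
  · intro κ hκ
    obtain ⟨x, -, rfl⟩ := Finset.mem_image.1 hκ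
    exact norm_branch _ _ _
  · intro κ j n hne
    obtain ⟨h1, h2⟩ := hc _ _ _ (right_ne_zero_of_mul hne)
    refine ⟨?_, h2⟩
    obtain ⟨r, hr, hr'⟩ := exists_floor_mu hh κ
    refine Finset.mem_image.2 ⟨(κ ^ h, ⟨r, hr⟩), by simpa using h1, ?_⟩
    exact (eq_branch hh (norm_eq_one_of_norm_pow hh (hS _ h1)) hr').symm
  · intro κ j n hn
    obtain ⟨r, hr, hr'⟩ := exists_floor_mu hh κ
    beta_reduce
    rw [hM, mul_zero]
    rw [hr']
    have h1 : (n + 1) < M / h := by omega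
    have h2 := (Int.le_ediv_iff_mul_le (by exact_mod_cast hh)).1 (Int.add_one_le_iff.2 h1)
    have h3 : (r : ℤ) < h := by exact_mod_cast hr
    have h4 : (0 : ℤ) < h := by exact_mod_cast hh
    nlinarith
  · intro κ j τ
    refine ((hsub (κ ^ h) j τ ⌊h * mu κ⌋).mul_left ((h : ℂ) ^ j)⁻¹).congr fun n ↦ ?_
    ring
  · intro τ
    rw [hf, Finset.sum_image hb, Finset.sum_product]
    refine Finset.sum_congr rfl fun l hl ↦ ?_
    simp only [logSum, b]
    rw [Finset.sum_comm]
    refine Finset.sum_congr rfl fun j _ ↦ ?_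
    -- The exponents of `q^{1/h}` are sorted by their residue `r` modulo `h`.
    have hdiv : ∑' n : ℤ, Complex.exp (n * logq (h * w) τ) * c l j n =
        ∑ r : Fin h, Complex.exp ((r : ℕ) * logq (h * w) τ) *
          ∑' n : ℤ, Complex.exp (n * logq w τ) * c l j (h * n + (r : ℕ)) := by
      rw [← (Int.divModEquiv h).symm.tsum_eq]
      have hs := (Int.divModEquiv h).symm.summable_iff.2 (hsum l j τ)
      have hs' := (Equiv.prodComm (Fin h) ℤ).summable_iff.2 hs
      rw [← (Equiv.prodComm (Fin h) ℤ).tsum_eq]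
      refine hs'.tsum_prod.trans ?_
      rw [tsum_fintype]
      refine Finset.sum_congr rfl fun r _ ↦ ?_
      rw [← tsum_mul_left]
      refine tsum_congr fun n ↦ ?_
      have e : (Int.divModEquiv h).symm ((Equiv.prodComm (Fin h) ℤ) (r, n)) = h * n + (r : ℕ) := by
        simp [Int.divModEquiv, mul_comm]
      simp only [Function.comp_apply]
      rw [e]
      have := hexp n (r : ℕ) τ
      rw [this]
      push_cast
      ring
    rw [hdiv, Finset.mul_sum]
    refine Finset.sum_congr rfl fun r _ ↦ ?_
    rw [branch_pow hh (hS l hl), floor_mu_branch l r.2, mu_branch l r.2]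
    have e1 : Complex.exp ((((mu l + (r : ℕ)) / h : ℝ) : ℂ) * logq w τ) =
        Complex.exp (mu l * logq (h * w) τ) * Complex.exp ((r : ℕ) * logq (h * w) τ) := by
      rw [← Complex.exp_add, logq_natCast_mul hh]
      congr 1
      push_cast
      field_simp
    have e2 : ∑' n : ℤ, Complex.exp (n * logq w τ) * (((h : ℂ) ^ j)⁻¹ * c l j (h * n + (r : ℕ))) =
        ((h : ℂ) ^ j)⁻¹ * ∑' n : ℤ, Complex.exp (n * logq w τ) * c l j (h * n + (r : ℕ)) := by
      rw [← tsum_mul_left]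
      exact tsum_congr fun n ↦ by ring
    rw [e1, e2, logq_natCast_mul hh, mul_pow, inv_pow]
    ring

end LogExpansion

/-! ### Fourier expansions of vector-valued functions -/

section Fourier

/-- Translation of `X` is `T` on values, so `(T - κ)^k` on vectors becomes `(translOp w - κ)^k` on
components. The free factor `B` lets the induction absorb one power at a time, and is later a
projection. -/
theorem translOp_sub_pow_apply {ι : Type*} {X : ℍ → ι → ℂ} {w : ℝ} {T : Module.End ℂ (ι → ℂ)} (hX : ∀ τ, X (w +ᵥ τ) = T (X τ))
    (κ : ℂ) (i : ι) (k : ℕ) : ∀ B : Module.End ℂ (ι → ℂ),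
    ((translOp w - algebraMap ℂ (Module.End ℂ (ℍ → ℂ)) κ) ^ k) (fun τ ↦ B (X τ) i) =
      fun τ ↦ (B * (T - algebraMap ℂ _ κ) ^ k) (X τ) i := by
  induction k with
  | zero => intro B; simp
  | succ k ih =>
    intro B
    have h1 : (translOp w - algebraMap ℂ (Module.End ℂ (ℍ → ℂ)) κ) (fun τ ↦ B (X τ) i) =
        fun τ ↦ (B * (T - algebraMap ℂ _ κ)) (X τ) i := by
      funext τ
      rw [translOp_sub_apply]
      simp [hX, Module.algebraMap_end_apply]
    rw [pow_succ, Module.End.mul_apply, h1, ih]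
    simp only [mul_assoc, ← pow_succ']

variable {ι : Type} [Fintype ι] [DecidableEq ι] {Γ : Subgroup SL(2, ℝ)} {ρ : Γ →* GL ι ℂ}
  {X : ℍ → ι → ℂ}

theorem IsFourierExpansion.hasLogExpansion {coef : ℂ → ℕ → ℤ → ι → ℂ}
    (h : IsFourierExpansion ρ X coef) (hT : ∀ κ ∈ eigs (monodromy ρ), ‖κ‖ = 1) (i : ι) :
    HasLogExpansion (cuspWidth Γ OnePoint.infty) (fun τ ↦ X τ i) fun κ j n ↦ coef κ j n i := by
  set T := monodromy ρ with hTdef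
  have hJ : ∀ κ ∈ eigs T, jordanSize T κ ≤ (eigs T).sup (jordanSize T) := fun κ hκ ↦
    Finset.le_sup hκ
  have hsupp : ∀ κ j n, coef κ j n i ≠ 0 → κ ∈ eigs T ∧ j < jordanSize T κ := fun κ j n hne ↦
    h.support κ j n fun h0 ↦ hne (by rw [h0]; rfl)
  -- One bound on the power of the logarithm serves all eigenvalues; the surplus terms are zero by
  -- `support`.
  refine ⟨eigs T, (eigs T).sup (jordanSize T), hT, fun κ j n hne ↦ ?_, ?_, fun κ j τ ↦ ?_,
    fun τ ↦ ?_⟩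
  · obtain ⟨h1, h2⟩ := hsupp κ j n hne
    exact ⟨h1, h2.trans_le (hJ κ h1)⟩
  · obtain ⟨M, hM⟩ := h.finite_start
    exact ⟨M, fun κ j n hn ↦ congrFun (hM κ j n hn) i⟩
  · exact Pi.summable.1 (h.summable κ j τ) i
  · beta_reduce
    rw [h.expansion τ, Finset.sum_apply]
    refine Finset.sum_congr rfl fun κ hκ ↦ ?_
    rw [Finset.sum_apply, logSum]
    refine Finset.sum_subset_zero_on_sdiff (by simpa using hJ κ hκ) (fun j hj ↦ ?_) fun j _ ↦ ?_
    · have : ∀ n, coef κ j n i = 0 := fun n ↦ by_contra fun hne ↦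
        (Finset.mem_sdiff.1 hj).2 (Finset.mem_range.2 (hsupp κ j n hne).2)
      simp [this]
    · rw [Pi.smul_apply, tsum_apply (h.summable κ j τ)]
      rfl

theorem IsFourierExpansion.unique {coef coef' : ℂ → ℕ → ℤ → ι → ℂ}
    (hw : 0 < cuspWidth Γ OnePoint.infty) (hT : ∀ κ ∈ eigs (monodromy ρ), ‖κ‖ = 1)
    (h : IsFourierExpansion ρ X coef) (h' : IsFourierExpansion ρ X coef') : coef = coef' := by
  funext κ j n i
  exact congrFun (congrFun (congrFun
    ((h.hasLogExpansion hT i).unique hw (h'.hasLogExpansion hT i)) κ) j) n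

/-- Existence of Fourier expansions, with coefficients in the generalized eigenspaces of the
monodromy. -/
theorem exists_isFourierExpansion (hw : 0 < cuspWidth Γ OnePoint.infty)
    (hT : ∀ κ ∈ eigs (monodromy ρ), ‖κ‖ = 1) (htame : ∀ i, IsTame fun τ ↦ X τ i)
    (hX : ∀ τ, X (cuspWidth Γ OnePoint.infty +ᵥ τ) = (monodromy ρ).mulVec (X τ)) :
    ∃ coef, IsFourierExpansion ρ X coef ∧
      ∀ κ j n, coef κ j n ∈ Module.End.maxGenEigenspace (monodromy ρ).toLin' κ := by
  classical
  set w := cuspWidth Γ OnePoint.infty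
  set T := monodromy ρ with hTdef
  obtain ⟨p, hp1, hp2, hp3⟩ := exists_genEigenspace_projections T.toLin'
  have hsum : ∀ v, v = ∑ κ ∈ eigs T, p κ v := by
    have : LinearMap.id = ∑ κ ∈ eigs T, p κ := by
      refine ext_maxGenEigenspace T.toLin' fun κ v hv ↦ ?_
      by_cases hv0 : v = 0
      · simp [hv0]
      rw [LinearMap.sum_apply, Finset.sum_eq_single κ]
      · rw [hp2 κ v hv]; rfl
      · intro l _ hl
        exact hp3 κ l hl.symm v hv
      · exact fun h ↦ absurd (mem_eigs_of_mem_maxGenEigenspace hv0 hv) h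
    intro v
    conv_lhs => rw [← LinearMap.id_apply (R := ℂ) v, this, LinearMap.sum_apply]
  -- On the generalized eigenspace of `κ` the power is zero by the choice of `jordanSize`; the other
  -- ones are stable under `T - κ` and killed by `p κ`.
  have hkill : ∀ κ, p κ * (T.toLin' - algebraMap ℂ _ κ) ^ jordanSize T κ = 0 := by
    intro κ
    refine ext_maxGenEigenspace T.toLin' fun l v hv ↦ ?_
    rw [Module.End.mul_apply, LinearMap.zero_apply]
    by_cases hl : l = κ
    · subst hl
      rw [Module.End.maxGenEigenspace_eq, Module.End.mem_genEigenspace_nat, LinearMap.mem_ker] at hv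
      rw [Algebra.algebraMap_eq_smul_one, jordanSize, hv, map_zero]
    · refine hp3 l κ hl _ (Module.End.mapsTo_maxGenEigenspace_of_comm ?_ l hv)
      exact ((Commute.refl T.toLin').sub_right (Algebra.commutes κ T.toLin').symm).pow_right _
  have hcomp : ∀ κ i, IsTame fun τ ↦ p κ (X τ) i := by
    intro κ i
    have h1 : ∀ τ, p κ (X τ) i = ∑ x, LinearMap.toMatrix' (p κ) i x * X τ x := fun τ ↦ by
      rw [← LinearMap.toMatrix'_mulVec]; rfl
    simp only [h1]
    exact isTame_sum _ fun x _ ↦ (htame x).const_mul _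
  have hlog : ∀ κ i, ∃ g : ℕ → ℍ → ℂ, κ ∈ eigs T → (∀ j, IsTame (g j)) ∧
      (∀ j τ, g j (w +ᵥ τ) = g j τ) ∧ (fun τ ↦ p κ (X τ) i) = logSum w κ (jordanSize T κ) g := by
    intro κ i
    by_cases hκ : κ ∈ eigs T
    · obtain ⟨g, hg⟩ := exists_logSum hw (hT κ hκ) (jordanSize T κ) _ (hcomp κ i) (by
        rw [translOp_sub_pow_apply (T := T.toLin') (by simpa using hX), hkill]
        rfl)
      exact ⟨g, fun _ ↦ hg⟩
    · exact ⟨0, fun h ↦ absurd h hκ⟩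
  choose g hg using hlog
  have hlaur : ∀ κ i j, ∃ (a : ℤ → ℂ) (M : ℤ), κ ∈ eigs T → (∀ n < M, a n = 0) ∧
      ∀ τ : ℍ, HasSum (fun n : ℤ ↦ Complex.exp (n * logq w τ) * a n) (g κ i j τ) := by
    intro κ i j
    by_cases hκ : κ ∈ eigs T
    · obtain ⟨a, M, h⟩ := exists_laurent hw ((hg κ i hκ).1 j) ((hg κ i hκ).2.1 j)
      exact ⟨a, M, fun _ ↦ h⟩
    · exact ⟨0, 0, fun h ↦ absurd h hκ⟩
  choose a M ha using hlaur
  let b : ℂ → ℕ → ℤ → ι → ℂ := fun κ j n i ↦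
    if κ ∈ eigs T ∧ j < jordanSize T κ then a κ i j n else 0
  let P : ℂ → (ι → ℂ) →L[ℂ] ι → ℂ := fun κ ↦ LinearMap.toContinuousLinearMap (p κ)
  have hbs : ∀ κ j (τ : ℍ), Summable fun n : ℤ ↦ Complex.exp (n * logq w τ) • b κ j n := by
    intro κ j τ
    refine Pi.summable.2 fun i ↦ ?_
    by_cases hκ : κ ∈ eigs T ∧ j < jordanSize T κ
    · simpa [b, hκ] using ((ha κ i j hκ.1).2 τ).summable
    · simp [b, hκ]
  have hPb : ∀ κ j (τ : ℍ), (fun n : ℤ ↦ Complex.exp (n * logq w τ) • p κ (b κ j n)) =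
      fun n : ℤ ↦ P κ (Complex.exp (n * logq w τ) • b κ j n) := by
    intro κ j τ
    funext n
    rw [map_smul]; rfl
  -- Projecting once more puts the coefficients into the generalized eigenspace. The expansion
  -- survives since `p κ` fixes `p κ (X τ)` and, being continuous, commutes with the sum.
  refine ⟨fun κ j n ↦ p κ (b κ j n), ⟨fun κ j n hne ↦ ?_, ?_, fun κ j τ ↦ ?_, fun τ ↦ ?_⟩,
    fun κ j n ↦ hp1 κ _⟩
  · by_contra hκ
    apply hne
    have : b κ j n = 0 := by
      funext i
      exact if_neg hκ
    rw [this, map_zero]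
  · obtain ⟨M₀, hM₀⟩ := ((eigs T ×ˢ (Finset.univ : Finset ι) ×ˢ
      Finset.range ((eigs T).sup (jordanSize T))).image fun x ↦ M x.1 x.2.1 x.2.2).bddBelow
    refine ⟨M₀, fun κ j n hn ↦ ?_⟩
    have : b κ j n = 0 := by
      funext i
      by_cases hκ : κ ∈ eigs T ∧ j < jordanSize T κ
      · have h1 : M₀ ≤ M κ i j := hM₀ (Finset.mem_coe.2 <| Finset.mem_image.2 ⟨(κ, i, j), by
          simpa [hκ.1] using hκ.2.trans_le (Finset.le_sup hκ.1), rfl⟩)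
        simp [b, hκ, (ha κ i j hκ.1).1 n (by omega)]
      · exact if_neg hκ
    rw [this, map_zero]
  · rw [hPb]
    exact (P κ).summable (hbs κ j τ)
  · conv_lhs => rw [hsum (X τ)]
    refine Finset.sum_congr rfl fun κ hκ ↦ ?_
    replace hκ : κ ∈ eigs T := hκ
    have h1 : p κ (X τ) = ∑ j ∈ Finset.range (jordanSize T κ),
        (logq w τ ^ j * Complex.exp (mu κ * logq w τ)) •
          ∑' n : ℤ, Complex.exp (n * logq w τ) • b κ j n := by
      funext i
      rw [Finset.sum_apply]
      have h2 := congrFun (hg κ i hκ).2.2 τ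
      simp only [logSum] at h2
      rw [h2]
      refine Finset.sum_congr rfl fun j hj ↦ ?_
      rw [Pi.smul_apply, tsum_apply (hbs κ j τ), ← ((ha κ i j hκ).2 τ).tsum_eq, smul_eq_mul]
      have hj' := Finset.mem_range.1 hj
      simp [b, hκ, hj']
    have h3 := congrArg (p κ) h1
    rw [hp2 κ _ (hp1 κ (X τ)), map_sum] at h3
    rw [h3]
    refine Finset.sum_congr rfl fun j _ ↦ ?_
    rw [map_smul, hPb, ← (P κ).map_tsum (hbs κ j τ)]
    rfl

theorem IsFourierExpansion.mem_maxGenEigenspace (hw : 0 < cuspWidth Γ OnePoint.infty)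
    (hT : ∀ κ ∈ eigs (monodromy ρ), ‖κ‖ = 1) (htame : ∀ i, IsTame fun τ ↦ X τ i)
    (hX : ∀ τ, X (cuspWidth Γ OnePoint.infty +ᵥ τ) = (monodromy ρ).mulVec (X τ))
    {coef : ℂ → ℕ → ℤ → ι → ℂ} (h : IsFourierExpansion ρ X coef) (κ : ℂ) (j : ℕ) (n : ℤ) :
    coef κ j n ∈ Module.End.maxGenEigenspace (monodromy ρ).toLin' κ := by
  obtain ⟨coef', h1, h2⟩ := exists_isFourierExpansion hw hT htame hX
  rw [h.unique hw hT h1]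
  exact h2 κ j n

end Fourier

/-! ### Cusps and growth -/

section Cusps

open Matrix.SpecialLinearGroup

theorem mapGL_isParabolic_iff (γ : SL(2, ℝ)) :
    (mapGL ℝ γ).IsParabolic ↔ Matrix.IsParabolic (γ : Matrix (Fin 2) (Fin 2) ℝ) := by
  rw [Matrix.GeneralLinearGroup.IsParabolic]
  simp

theorem isParabolic_conj (s γ : SL(2, ℝ)) :
    Matrix.IsParabolic ((s * γ * s⁻¹ : SL(2, ℝ)) : Matrix (Fin 2) (Fin 2) ℝ) ↔
      Matrix.IsParabolic (γ : Matrix (Fin 2) (Fin 2) ℝ) := by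
  rw [← mapGL_isParabolic_iff, ← mapGL_isParabolic_iff, map_mul, map_mul, map_inv,
    Matrix.GeneralLinearGroup.isParabolic_conj_iff]

theorem isParabolic_conj' (s γ : SL(2, ℝ)) :
    Matrix.IsParabolic ((s⁻¹ * γ * s : SL(2, ℝ)) : Matrix (Fin 2) (Fin 2) ℝ) ↔
      Matrix.IsParabolic (γ : Matrix (Fin 2) (Fin 2) ℝ) := by
  simpa using isParabolic_conj s⁻¹ γ

theorem isParabolic_pow {γ : SL(2, ℝ)} (h : Matrix.IsParabolic (γ : Matrix (Fin 2) (Fin 2) ℝ))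
    {n : ℕ} (hn : n ≠ 0) :
    Matrix.IsParabolic ((γ ^ n : SL(2, ℝ)) : Matrix (Fin 2) (Fin 2) ℝ) := by
  rw [← mapGL_isParabolic_iff] at h ⊢
  rw [map_pow]
  exact h.pow hn

theorem isCusp_toGL_iff {Γ : Subgroup SL(2, ℝ)} {c : OnePoint ℝ} :
    IsCusp c (toGL Γ) ↔ ∃ γ ∈ Γ, Matrix.IsParabolic (γ : Matrix (Fin 2) (Fin 2) ℝ) ∧
      mapGL ℝ γ • c = c := by
  constructor
  · rintro ⟨_, ⟨γ, hγ, rfl⟩, h1, h2⟩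
    exact ⟨γ, hγ, (mapGL_isParabolic_iff γ).1 h1, h2⟩
  · rintro ⟨γ, hγ, h1, h2⟩
    exact ⟨_, ⟨γ, hγ, rfl⟩, (mapGL_isParabolic_iff γ).2 h1, h2⟩

theorem scaling_smul_infty (c : OnePoint ℝ) :
    mapGL ℝ (scaling c) • (OnePoint.infty : OnePoint ℝ) = c := by
  cases c using OnePoint.rec with
  | infty =>
    have : scaling OnePoint.infty = 1 := rfl
    rw [this, map_one, one_smul]
  | coe x =>
    have h00 : mapGL ℝ (scaling (x : OnePoint ℝ)) 0 0 = x := rfl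
    have h10 : mapGL ℝ (scaling (x : OnePoint ℝ)) 1 0 = 1 := rfl
    rw [OnePoint.smul_infty_eq_ite, h00, h10]
    simp

theorem mem_conjSubgroup {s γ : SL(2, ℝ)} {Γ : Subgroup SL(2, ℝ)} :
    γ ∈ conjSubgroup s Γ ↔ s⁻¹ * γ * s ∈ Γ := by
  rw [conjSubgroup, Subgroup.mem_map]
  constructor
  · rintro ⟨δ, hδ, rfl⟩
    simpa [mul_assoc] using hδ
  · intro h
    exact ⟨_, h, by simp [mul_assoc]⟩

theorem isCusp_of_conj {s : SL(2, ℝ)} {Γ : Subgroup SL(2, ℝ)} {c : OnePoint ℝ}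
    (h : IsCusp c (toGL (conjSubgroup s Γ))) : IsCusp (mapGL ℝ s⁻¹ • c) (toGL Γ) := by
  rw [isCusp_toGL_iff] at h ⊢
  obtain ⟨γ, hγ, h1, h2⟩ := h
  refine ⟨s⁻¹ * γ * s, mem_conjSubgroup.1 hγ, (isParabolic_conj' s γ).2 h1, ?_⟩
  rw [← mul_smul, ← map_mul, mul_assoc, mul_inv_cancel, mul_one, map_mul, mul_smul, h2]

/-- An upper triangular `M` acts by `τ ↦ a² τ + a b`, where `(a, b)` is its top row, so it maps
vertical strips into vertical strips. -/
theorem moderateGrowth_comp {ι : Type} [Fintype ι] {X : ℍ → ι → ℂ} {M : SL(2, ℝ)}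
    (hM : M 1 0 = 0) (hX : ModerateGrowth X) : ModerateGrowth fun τ ↦ X (M • τ) := by
  have hdet : M 0 0 * M 1 1 = 1 := by
    have := M.det_coe
    rw [Matrix.det_fin_two, hM] at this
    simpa using this
  have h11 : M 1 1 ≠ 0 := right_ne_zero_of_mul_eq_one hdet
  have h00 : M 0 0 ≠ 0 := left_ne_zero_of_mul_eq_one hdet
  have hcoe : ∀ τ : ℍ, ((M • τ : ℍ) : ℂ) = ((M 0 0 ^ 2 : ℝ) : ℂ) * τ + ((M 0 0 * M 0 1 : ℝ) : ℂ) := by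
    intro τ
    have h3 : (M 1 1 : ℂ) ≠ 0 := by exact_mod_cast h11
    have h4 : (M 0 0 : ℂ) * M 1 1 = 1 := by exact_mod_cast hdet
    rw [coe_specialLinearGroup_apply]
    simp only [Algebra.algebraMap_self, RingHom.id_apply]
    have h5 : ((M 1 0 : ℝ) : ℂ) = 0 := by rw [hM, Complex.ofReal_zero]
    rw [h5, zero_mul, zero_add, div_eq_iff h3]
    push_cast
    linear_combination (-(M 0 0 : ℂ) * τ - (M 0 1 : ℂ)) * h4
  have hpos : 0 < M 0 0 ^ 2 := by positivity
  have him : ∀ τ : ℍ, (M • τ).im = M 0 0 ^ 2 * τ.im := fun τ ↦ by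
    rw [← coe_im, hcoe, Complex.add_im, Complex.im_ofReal_mul]; simp
  have hre : ∀ τ : ℍ, (M • τ).re = M 0 0 ^ 2 * τ.re + M 0 0 * M 0 1 := fun τ ↦ by
    rw [← coe_re, hcoe, Complex.add_re, Complex.re_ofReal_mul]; simp
  intro B
  obtain ⟨C, Y, h⟩ := hX (M 0 0 ^ 2 * B + |M 0 0 * M 0 1|)
  refine ⟨C * M 0 0 ^ 2, Y / M 0 0 ^ 2, fun τ hB hτ ↦ ?_⟩
  have := h (M • τ) (by
    rw [hre]
    refine (abs_add_le _ _).trans (add_le_add_left ?_ _)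
    rw [abs_mul, abs_of_pos hpos]
    exact mul_le_mul_of_nonneg_left hB hpos.le) (by
    rw [him]
    rw [div_lt_iff₀ hpos] at hτ
    linarith)
  rw [him, ← mul_assoc] at this
  exact this

theorem stroke_zero {ι : Type} (γ : SL(2, ℝ)) (X : ℍ → ι → ℂ) :
    stroke 0 γ X = fun τ ↦ X (γ • τ) := by
  funext τ
  simp [stroke]

variable {ι : Type} [Fintype ι] [DecidableEq ι] {Γ : Subgroup SL(2, ℝ)} {ρ : Γ →* GL ι ℂ}
  {X : ℍ → ι → ℂ}

/-- Both `s A_c` and `A_{s c}` take `∞` to `s c`, so they differ by an upper triangular matrix on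
the right. -/
theorem IsWeaklyHolomorphicVVAF.moderateGrowth_smul (hX : IsWeaklyHolomorphicVVAF 0 Γ ρ X)
    (s : SL(2, ℝ)) (c : OnePoint ℝ) (hc : IsCusp (mapGL ℝ s • c) (toGL Γ)) :
    ModerateGrowth fun τ ↦ X (s • scaling c • τ) := by
  set c' := mapGL ℝ s • c with hc'
  have h1 := hX.cusps c' hc
  rw [stroke_zero] at h1
  let M : SL(2, ℝ) := (scaling c')⁻¹ * s * scaling c
  have hM : M 1 0 = 0 := by
    have h2 : mapGL ℝ M • (OnePoint.infty : OnePoint ℝ) = OnePoint.infty := by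
      rw [map_mul, map_mul, mul_smul, mul_smul, scaling_smul_infty, ← hc', map_inv,
        inv_smul_eq_iff, scaling_smul_infty]
    rw [OnePoint.smul_infty_eq_self_iff] at h2
    simpa using h2
  have h3 := moderateGrowth_comp hM h1
  convert h3 using 2 with τ
  rw [← mul_smul, ← mul_smul, ← mul_assoc, ← mul_assoc, mul_inv_cancel, one_mul]

theorem differentiableOn_smul {α : Type*} {X : ℍ → α → ℂ}
    (h : DifferentiableOn ℂ (X ∘ ofComplex) {z : ℂ | 0 < z.im}) (s : SL(2, ℝ)) :
    DifferentiableOn ℂ ((fun τ ↦ X (s • τ)) ∘ ofComplex) {z : ℂ | 0 < z.im} := by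
  rw [differentiableOn_pi] at h ⊢
  intro i
  have h1 := UpperHalfPlane.mdifferentiable_iff (f := fun τ ↦ X τ i) |>.2 (h i)
  have h2 := UpperHalfPlane.mdifferentiable_smul (g := mapGL ℝ s) (by simp)
  exact UpperHalfPlane.mdifferentiable_iff.1 (h1.comp h2)

theorem repMat_conjRep (s γ : SL(2, ℝ)) :
    repMat (conjRep s ρ) γ = repMat ρ (s⁻¹ * γ * s) := by
  by_cases h : γ ∈ conjSubgroup s Γ
  · have h' := mem_conjSubgroup.1 h
    rw [repMat, repMat, dif_pos h, dif_pos h']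
    have : ((MulAut.conj s : SL(2, ℝ) ≃* SL(2, ℝ)).subgroupMap Γ).symm ⟨γ, h⟩ =
        ⟨s⁻¹ * γ * s, h'⟩ := by
      rw [MulEquiv.symm_apply_eq]
      ext1
      simp [mul_assoc]
    simp [conjRep, this]
  · have h' := fun h' ↦ h (mem_conjSubgroup.2 h')
    rw [repMat, repMat, dif_neg h, dif_neg h']

/-- Moving a form by an element of `SL₂(ℝ)`. -/
theorem IsWeaklyHolomorphicVVAF.conj (hX : IsWeaklyHolomorphicVVAF 0 Γ ρ X) (s : SL(2, ℝ)) :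
    IsWeaklyHolomorphicVVAF 0 (conjSubgroup s Γ) (conjRep s ρ) (stroke 0 s⁻¹ X) where
  unitary γ hγ hp κ hκ := by
    rw [repMat_conjRep] at hκ
    exact hX.unitary _ (mem_conjSubgroup.1 hγ) ((isParabolic_conj' s γ).2 hp) κ hκ
  neg_one := by
    rw [repMat_conjRep]
    simpa using hX.neg_one
  holo := by
    rw [stroke_zero]
    exact differentiableOn_smul hX.holo _
  functional γ hγ τ := by
    have := hX.functional _ (mem_conjSubgroup.1 hγ) (s⁻¹ • τ)
    simp only [stroke_zero] at this ⊢
    rw [repMat_conjRep, ← this, ← mul_smul, ← mul_smul]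
    congr 2
    group
  cusps c hc := by
    simp only [stroke_zero]
    exact hX.moderateGrowth_smul s⁻¹ c (isCusp_of_conj hc)

end Cusps

/-! ### The induced representation -/

section Induced

open Matrix.SpecialLinearGroup

variable {Γ Δ : Subgroup SL(2, ℝ)} {d m : ℕ}

theorem CosetReps.eq_of_mem (g : CosetReps Γ Δ d) {a b : Fin d} (h : (g.rep a)⁻¹ * g.rep b ∈ Δ) :
    a = b :=
  (g.existsUnique_rep _ (g.rep_mem b)).unique h (by simp [Δ.one_mem])

/-- Multiplication by `γ` sends distinct cosets to distinct ones, so block row `a` has only one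
nonzero block. -/
theorem inducedMatrix_mulVec (g : CosetReps Γ Δ d) (ρ : Δ →* GL (Fin m) ℂ) {γ : SL(2, ℝ)}
    {a b : Fin d} (h : (g.rep a)⁻¹ * γ * g.rep b ∈ Δ) (v : Fin d × Fin m → ℂ) (i : Fin m) :
    (inducedMatrix g ρ γ).mulVec v (a, i) =
      (repMat ρ ((g.rep a)⁻¹ * γ * g.rep b)).mulVec (fun j ↦ v (b, j)) i := by
  rw [Matrix.mulVec, dotProduct, Fintype.sum_prod_type, Finset.sum_eq_single b]
  · rfl
  · intro b' _ hb'
    have : (g.rep a)⁻¹ * γ * g.rep b' ∉ Δ := fun h' ↦ hb' (g.eq_of_mem (by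
      have := Δ.mul_mem (Δ.inv_mem h') h
      simpa [mul_assoc] using this))
    simp [inducedMatrix, repMat, this]
  · simp

theorem repMat_inducedRep (g : CosetReps Γ Δ d) (ρ : Δ →* GL (Fin m) ℂ) {γ : SL(2, ℝ)}
    (h : γ ∈ Γ) : repMat (inducedRep g ρ) γ = inducedMatrix g ρ γ := by
  rw [repMat, dif_pos h]
  rfl

theorem inducedMatrix_pow (g : CosetReps Γ Δ d) (ρ : Δ →* GL (Fin m) ℂ) {γ : SL(2, ℝ)}
    (h : γ ∈ Γ) (n : ℕ) : inducedMatrix g ρ γ ^ n = inducedMatrix g ρ (γ ^ n) := by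
  induction n with
  | zero => rw [pow_zero, pow_zero, inducedMatrix_one]
  | succ n ih => rw [pow_succ, ih, ← inducedMatrix_mul g ρ _ _ h, ← pow_succ]

theorem CosetReps.exists_target (g : CosetReps Γ Δ d) {γ : SL(2, ℝ)} (h : γ ∈ Γ) (b : Fin d) :
    ∃ a, (g.rep a)⁻¹ * γ * g.rep b ∈ Δ := by
  obtain ⟨a, ha, -⟩ := g.existsUnique_rep (γ * g.rep b) (Γ.mul_mem h (g.rep_mem b))
  exact ⟨a, by simpa [mul_assoc] using ha⟩

theorem CosetReps.exists_source (g : CosetReps Γ Δ d) {γ : SL(2, ℝ)} (h : γ ∈ Γ) (a : Fin d) :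
    ∃ b, (g.rep a)⁻¹ * γ * g.rep b ∈ Δ := by
  obtain ⟨b, hb⟩ := g.exists_target (Γ.inv_mem h) a
  exact ⟨b, by simpa [mul_assoc] using Δ.inv_mem hb⟩

/-- Pigeonhole: two of the cosets `γⁿ g_a Δ` coincide. -/
theorem CosetReps.exists_pow_mem (g : CosetReps Γ Δ d) {γ : SL(2, ℝ)} (h : γ ∈ Γ) (a : Fin d) :
    ∃ n : ℕ, 0 < n ∧ (g.rep a)⁻¹ * γ ^ n * g.rep a ∈ Δ := by
  choose f hf using fun n : ℕ ↦ g.exists_target (Γ.pow_mem h n) a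
  obtain ⟨x, y, hxy, hfxy⟩ := Finite.exists_ne_map_eq_of_infinite f
  wlog hlt : x < y generalizing x y
  · exact this y x hxy.symm hfxy.symm (lt_of_le_of_ne (not_lt.1 hlt) hxy.symm)
  refine ⟨y - x, by omega, ?_⟩
  have h1 := hf x
  rw [hfxy] at h1
  have h2 := Δ.mul_mem (Δ.inv_mem h1) (hf y)
  have h3 : ((g.rep (f y))⁻¹ * γ ^ x * g.rep a)⁻¹ * ((g.rep (f y))⁻¹ * γ ^ y * g.rep a) =
      (g.rep a)⁻¹ * γ ^ (y - x) * g.rep a := by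
    obtain ⟨k, rfl⟩ := Nat.exists_eq_add_of_lt hlt
    rw [show x + k + 1 - x = k + 1 by omega, show x + k + 1 = x + (k + 1) by omega, pow_add γ x]
    group
  rwa [h3] at h2

/-- A power of the parabolic element that fixes `c`, conjugated into `Δ`, is still parabolic. This
gives the growth of every block of the lift. -/
theorem CosetReps.isCusp_smul (g : CosetReps Γ Δ d) {c : OnePoint ℝ} (hc : IsCusp c (toGL Γ))
    (a : Fin d) : IsCusp (mapGL ℝ (g.rep a)⁻¹ • c) (toGL Δ) := by
  rw [isCusp_toGL_iff] at hc ⊢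
  obtain ⟨γ, hγ, h1, h2⟩ := hc
  obtain ⟨n, hn, hmem⟩ := g.exists_pow_mem hγ a
  refine ⟨_, hmem, (isParabolic_conj' _ _).2 (isParabolic_pow h1 hn.ne'), ?_⟩
  rw [← mul_smul, ← map_mul, mul_assoc, mul_inv_cancel, mul_one, map_mul, mul_smul, map_pow]
  congr 1
  exact (MulAction.stabilizer (GL (Fin 2) ℝ) c).pow_mem h2 n

theorem moderateGrowth_lift (F : Fin d → ℍ → Fin m → ℂ) (hF : ∀ a, ModerateGrowth (F a)) :
    ModerateGrowth fun τ (x : Fin d × Fin m) ↦ F x.1 τ x.2 := by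
  intro B
  choose C Y h using fun a ↦ hF a B
  obtain ⟨C', hC'⟩ := (Set.finite_range C).bddAbove
  obtain ⟨Y', hY'⟩ := (Set.finite_range Y).bddAbove
  refine ⟨C', Y', fun τ hB hτ ↦ ?_⟩
  rw [pi_norm_lt_iff (Real.exp_pos _)]
  rintro ⟨a, i⟩
  have h1 : C a ≤ C' := hC' ⟨a, rfl⟩
  have h2 : Y a ≤ Y' := hY' ⟨a, rfl⟩
  calc ‖F a τ i‖ ≤ ‖F a τ‖ := norm_le_pi_norm _ i
    _ < Real.exp (C a * τ.im) := h a τ hB (by linarith)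
    _ ≤ Real.exp (C' * τ.im) :=
      Real.exp_le_exp.2 (mul_le_mul_of_nonneg_right h1 τ.im_pos.le)

/-- The lift of a form is a form for the induced representation. -/
theorem IsWeaklyHolomorphicVVAF.lift (g : CosetReps Γ Δ d) {ρ : Δ →* GL (Fin m) ℂ}
    {X : ℍ → Fin m → ℂ} (hX : IsWeaklyHolomorphicVVAF 0 Δ ρ X) (hneg : -1 ∈ Δ) (hneg' : -1 ∈ Γ) :
    IsWeaklyHolomorphicVVAF 0 Γ (inducedRep g ρ) (VVAF.lift g X) where
  unitary γ hγ hp κ hκ := by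
    rw [repMat_inducedRep g ρ hγ, mem_eigs_iff] at hκ
    obtain ⟨v, hv, hvκ⟩ := hκ
    -- A nonzero block of the eigenvector is an eigenvector of a power of `γ` conjugated into `Δ`,
    -- with eigenvalue `κ ^ n`.
    obtain ⟨⟨a, i⟩, hai⟩ := Function.ne_iff.1 hv
    obtain ⟨n, hn, hmem⟩ := g.exists_pow_mem hγ a
    have h1 := pow_mulVec_of_eigenvector hvκ n
    rw [inducedMatrix_pow g ρ hγ] at h1
    refine norm_eq_one_of_norm_pow hn (hX.unitary _ hmem
      ((isParabolic_conj' _ _).2 (isParabolic_pow hp hn.ne')) _ ?_)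
    rw [mem_eigs_iff]
    refine ⟨fun j ↦ v (a, j), fun h0 ↦ hai (congrFun h0 i), ?_⟩
    funext j
    rw [← inducedMatrix_mulVec g ρ hmem, h1]
    rfl
  neg_one := by
    rw [repMat_inducedRep g ρ hneg', zpow_zero, one_smul, ← inducedMatrix_one g ρ]
    ext ⟨a, i⟩ ⟨b, j⟩
    have h1 := repMat_mul_of_mem ρ ((g.rep a)⁻¹ * 1 * g.rep b) (-1) hneg
    rw [hX.neg_one, zpow_zero, one_smul, mul_one] at h1
    simp only [inducedMatrix, Matrix.of_apply]
    rw [h1]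
    simp
  holo := by
    rw [differentiableOn_pi]
    rintro ⟨a, i⟩
    exact differentiableOn_pi.1 (differentiableOn_smul hX.holo (g.rep a)⁻¹) i
  functional γ hγ τ := by
    rw [stroke_zero, repMat_inducedRep g ρ hγ]
    funext ⟨a, i⟩
    obtain ⟨b, hb⟩ := g.exists_source hγ a
    rw [inducedMatrix_mulVec g ρ hb]
    have := hX.functional _ hb ((g.rep b)⁻¹ • τ)
    rw [stroke_zero] at this
    rw [show (fun j ↦ VVAF.lift g X τ (b, j)) = X ((g.rep b)⁻¹ • τ) from rfl, ← this]
    beta_reduce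
    rw [show VVAF.lift g X (γ • τ) (a, i) = X ((g.rep a)⁻¹ • γ • τ) i from rfl, ← mul_smul,
      ← mul_smul]
    congr 2
    group
  cusps c hc := by
    rw [stroke_zero]
    exact moderateGrowth_lift (fun a τ ↦ X ((g.rep a)⁻¹ • scaling c • τ))
      fun a ↦ hX.moderateGrowth_smul _ c (g.isCusp_smul hc a)

end Induced

/-! ### Cusp widths -/

section Width

open Matrix.SpecialLinearGroup

theorem transl_add (x y : ℝ) : transl (x + y) = transl x * transl y := by
  ext i j
  rw [coe_mul]
  fin_cases i <;> fin_cases j <;> simp [transl, Matrix.mul_apply, Fin.sum_univ_two, add_comm]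

theorem transl_zero : transl 0 = 1 := by
  ext i j
  fin_cases i <;> fin_cases j <;> simp [transl]

theorem transl_neg (x : ℝ) : transl (-x) = (transl x)⁻¹ := by
  rw [eq_inv_iff_mul_eq_one, ← transl_add, neg_add_cancel, transl_zero]

theorem transl_nat_mul (n : ℕ) (x : ℝ) : transl (n * x) = transl x ^ n := by
  induction n with
  | zero => simp [transl_zero]
  | succ n ih => rw [pow_succ, ← ih, ← transl_add]; push_cast; ring_nf

theorem transl_smul (x : ℝ) (τ : ℍ) : transl x • τ = x +ᵥ τ := by
  ext
  rw [coe_specialLinearGroup_apply, coe_vadd]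
  simp [transl, add_comm]

theorem isParabolic_transl {x : ℝ} (hx : x ≠ 0) :
    Matrix.IsParabolic (transl x : Matrix (Fin 2) (Fin 2) ℝ) := by
  rw [Matrix.isParabolic_iff_of_upperTriangular (by simp [transl])]
  simpa [transl] using hx

/-- The group of translations in `Γ`. -/
def translations (Γ : Subgroup SL(2, ℝ)) : AddSubgroup ℝ where
  carrier := {x | transl x ∈ Γ}
  add_mem' hx hy := by
    simp only [Set.mem_ofPred_eq, transl_add] at hx hy ⊢
    exact Γ.mul_mem hx hy
  zero_mem' := by
    simp only [Set.mem_ofPred_eq, transl_zero]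
    exact Γ.one_mem
  neg_mem' hx := by
    simp only [Set.mem_ofPred_eq, transl_neg] at hx ⊢
    exact Γ.inv_mem hx

theorem mem_translations {Γ : Subgroup SL(2, ℝ)} {x : ℝ} :
    x ∈ translations Γ ↔ transl x ∈ Γ := Iff.rfl

theorem continuous_transl : Continuous transl := by
  refine Continuous.subtype_mk ?_ _
  refine continuous_matrix fun i j ↦ ?_
  fin_cases i <;> fin_cases j <;> simp <;> fun_prop

theorem transl_injective : Function.Injective transl := fun x y h ↦ by
  have := congrArg (fun γ : SL(2, ℝ) ↦ γ 0 1) h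
  simpa [transl] using this

/-- The map `x ↦ s⁻¹ t^x s` is a continuous injection into the discrete group `Γ`. -/
theorem discreteTopology_translations_conj {Γ : Subgroup SL(2, ℝ)} [DiscreteTopology Γ]
    (s : SL(2, ℝ)) : DiscreteTopology (translations (conjSubgroup s Γ)) := by
  let f : translations (conjSubgroup s Γ) → Γ := fun x ↦
    ⟨s⁻¹ * transl x * s, mem_conjSubgroup.1 x.2⟩
  refine DiscreteTopology.of_continuous_injective (f := f) ?_ fun x y h ↦ ?_
  · exact Continuous.subtype_mk
      ((continuous_const.mul (continuous_transl.comp continuous_subtype_val)).mul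
        continuous_const) _
  · have h1 : s⁻¹ * transl x * s = s⁻¹ * transl y * s := congrArg Subtype.val h
    exact Subtype.ext (transl_injective (mul_left_cancel (mul_right_cancel h1)))

theorem cuspWidth_infty (Γ : Subgroup SL(2, ℝ)) :
    cuspWidth Γ OnePoint.infty = sInf {w : ℝ | 0 < w ∧ transl w ∈ Γ} := by
  have : scaling OnePoint.infty = 1 := rfl
  simp [cuspWidth, this]

/-- At a cusp `c` of a discrete group, the cusp width is positive, and it generates the
translations. -/
theorem cuspWidth_conj_scaling {Γ : Subgroup SL(2, ℝ)} [DiscreteTopology Γ] {c : OnePoint ℝ}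
    (hc : IsCusp c (toGL Γ)) :
    0 < cuspWidth (conjSubgroup (scaling c)⁻¹ Γ) OnePoint.infty ∧
      ∀ x, transl x ∈ conjSubgroup (scaling c)⁻¹ Γ ↔
        ∃ k : ℤ, x = k * cuspWidth (conjSubgroup (scaling c)⁻¹ Γ) OnePoint.infty := by
  set Γ' := conjSubgroup (scaling c)⁻¹ Γ with hΓ'
  have hdisc := discreteTopology_translations_conj (Γ := Γ) (scaling c)⁻¹
  obtain ⟨y, hy⟩ := (translations Γ').isAddCyclic_iff_exists_zmultiples_eq_top.1
    (AddSubgroup.discrete_iff_addCyclic.2 hdisc)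
  have hmem : ∀ x, transl x ∈ Γ' ↔ ∃ k : ℤ, x = k * |y| := by
    intro x
    rw [← mem_translations, ← hy, AddSubgroup.mem_zmultiples_iff]
    rcases abs_cases y with ⟨h, -⟩ | ⟨h, -⟩ <;> rw [h]
    · simp only [zsmul_eq_mul, eq_comm]
    · constructor
      · rintro ⟨k, rfl⟩
        exact ⟨-k, by simp⟩
      · rintro ⟨k, rfl⟩
        exact ⟨-k, by simp⟩
  have hy0 : 0 < |y| := by
    rw [isCusp_toGL_iff] at hc
    obtain ⟨γ, hγ, h1, h2⟩ := hc
    let δ : SL(2, ℝ) := (scaling c)⁻¹ * γ * scaling c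
    have hδ : δ ∈ Γ' := mem_conjSubgroup.2 (by simpa [δ, mul_assoc] using hγ)
    have hδ1 : (mapGL ℝ δ).IsParabolic :=
      (mapGL_isParabolic_iff _).2 ((isParabolic_conj' _ _).2 h1)
    have hδ2 : mapGL ℝ δ • (OnePoint.infty : OnePoint ℝ) = OnePoint.infty := by
      rw [map_mul, map_mul, mul_smul, mul_smul, scaling_smul_infty, h2, map_inv,
        inv_smul_eq_iff, scaling_smul_infty]
    rw [OnePoint.smul_infty_eq_self_iff] at hδ2
    have hdet : (mapGL ℝ δ).det = 1 := by simp
    rw [Matrix.GeneralLinearGroup.isParabolic_iff_of_upperTriangular_of_det (Or.inl hdet) hδ2]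
      at hδ1
    -- A parabolic element of determinant one fixing `∞` is `± t^x`; squaring removes the sign and
    -- leaves a nontrivial translation.
    have hsq : ∃ x ≠ 0, δ * δ = transl x := by
      rcases hδ1 with ⟨x, hx, hxδ⟩ | ⟨x, hx, hxδ⟩
      all_goals
        have h3 : (δ : Matrix (Fin 2) (Fin 2) ℝ) = ((mapGL ℝ δ : GL (Fin 2) ℝ) : Matrix _ _ ℝ) := rfl
        rw [hxδ] at h3
      · refine ⟨2 * x, by simpa using hx, ?_⟩
        ext i j
        rw [coe_mul, h3]
        fin_cases i <;> fin_cases j <;>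
          simp [transl, Matrix.GeneralLinearGroup.upperRightHom, Matrix.mul_apply,
            Fin.sum_univ_two, two_mul]
      · refine ⟨2 * x, by simpa using hx, ?_⟩
        ext i j
        rw [coe_mul, h3]
        fin_cases i <;> fin_cases j <;>
          simp [transl, Matrix.GeneralLinearGroup.upperRightHom, Matrix.mul_apply,
            Fin.sum_univ_two, two_mul]
    obtain ⟨x, hx, hxδ⟩ := hsq
    obtain ⟨k, hk⟩ := (hmem x).1 (hxδ ▸ Γ'.mul_mem hδ hδ)
    rw [abs_pos]
    rintro rfl
    simp [hx] at hk
  have hw : cuspWidth Γ' OnePoint.infty = |y| := by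
    rw [cuspWidth_infty]
    refine IsLeast.csInf_eq ⟨⟨hy0, (hmem _).2 ⟨1, by simp⟩⟩, ?_⟩
    rintro x ⟨hx0, hx⟩
    obtain ⟨k, rfl⟩ := (hmem x).1 hx
    have hk : (0 : ℝ) < k := pos_of_mul_pos_left hx0 hy0.le
    have hk' : (1 : ℝ) ≤ k := by exact_mod_cast (by exact_mod_cast hk : (0 : ℤ) < k)
    nlinarith
  rw [hw]
  exact ⟨hy0, hmem⟩

theorem isCusp_infty_of_transl_mem {Γ : Subgroup SL(2, ℝ)} {w : ℝ} (hw : w ≠ 0)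
    (h : transl w ∈ Γ) : IsCusp OnePoint.infty (toGL Γ) := by
  rw [isCusp_toGL_iff]
  refine ⟨_, h, isParabolic_transl hw, ?_⟩
  rw [OnePoint.smul_infty_eq_self_iff]
  rfl

end Width

/-! ### Fourier expansions of forms -/

section FormExpansion

variable {ι : Type} [Fintype ι] [DecidableEq ι] {Γ : Subgroup SL(2, ℝ)} {ρ : Γ →* GL ι ℂ}
  {X : ℍ → ι → ℂ}

theorem IsWeaklyHolomorphicVVAF.norm_eigs_monodromy (hX : IsWeaklyHolomorphicVVAF 0 Γ ρ X)
    (hw : 0 < cuspWidth Γ OnePoint.infty) (h : transl (cuspWidth Γ OnePoint.infty) ∈ Γ) :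
    ∀ κ ∈ eigs (monodromy ρ), ‖κ‖ = 1 :=
  hX.unitary _ h (isParabolic_transl hw.ne')

theorem IsWeaklyHolomorphicVVAF.isTame (hX : IsWeaklyHolomorphicVVAF 0 Γ ρ X)
    (h : IsCusp OnePoint.infty (toGL Γ)) (i : ι) : IsTame fun τ ↦ X τ i where
  holo := differentiableOn_pi.1 hX.holo i
  growth B := by
    have h1 := hX.cusps _ h
    have h2 : scaling OnePoint.infty = 1 := rfl
    rw [stroke_zero, h2] at h1
    simp only [one_smul] at h1
    obtain ⟨C, Y, h3⟩ := h1 B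
    exact ⟨C, Y, fun τ hB hτ ↦ (norm_le_pi_norm _ i).trans (h3 τ hB hτ).le⟩

theorem IsWeaklyHolomorphicVVAF.vadd (hX : IsWeaklyHolomorphicVVAF 0 Γ ρ X)
    (h : transl (cuspWidth Γ OnePoint.infty) ∈ Γ) (τ : ℍ) :
    X (cuspWidth Γ OnePoint.infty +ᵥ τ) = (monodromy ρ).mulVec (X τ) := by
  have := hX.functional _ h τ
  rw [stroke_zero] at this
  beta_reduce at this
  rwa [transl_smul] at this

theorem IsWeaklyHolomorphicVVAF.exists_isFourierExpansion (hX : IsWeaklyHolomorphicVVAF 0 Γ ρ X)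
    (hw : 0 < cuspWidth Γ OnePoint.infty) (h : transl (cuspWidth Γ OnePoint.infty) ∈ Γ) :
    ∃ coef, IsFourierExpansion ρ X coef :=
  let ⟨coef, hc, _⟩ := VVAF.exists_isFourierExpansion hw (hX.norm_eigs_monodromy hw h)
    (hX.isTame (isCusp_infty_of_transl_mem hw.ne' h)) (hX.vadd h)
  ⟨coef, hc⟩

theorem IsFourierExpansion.mem_maxGenEigenspace_of_form {coef : ℂ → ℕ → ℤ → ι → ℂ}
    (hc : IsFourierExpansion ρ X coef) (hX : IsWeaklyHolomorphicVVAF 0 Γ ρ X)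
    (hw : 0 < cuspWidth Γ OnePoint.infty) (h : transl (cuspWidth Γ OnePoint.infty) ∈ Γ)
    (κ : ℂ) (j : ℕ) (n : ℤ) :
    coef κ j n ∈ Module.End.maxGenEigenspace (monodromy ρ).toLin' κ :=
  hc.mem_maxGenEigenspace hw (hX.norm_eigs_monodromy hw h)
    (hX.isTame (isCusp_infty_of_transl_mem hw.ne' h)) (hX.vadd h) κ j n

end FormExpansion

/-! ### Cycles of cosets -/

section Cycles

open Function

/-- A base point is chosen in every cycle, and `ν a` counts the steps from it to `a`, modulo the
length of the cycle. -/
theorem exists_cycle_position {α : Type*} [Finite α] (σ : Equiv.Perm α) :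
    ∃ ν : α → ℕ, (∀ a, ν a < minimalPeriod σ a) ∧
      ∀ b n, n < minimalPeriod σ b → ∃ k, ν (σ^[k] b) = n := by
  classical
  have hper : ∀ a, a ∈ periodicPts σ := fun a ↦ σ.injective.mem_periodicPts a
  let r : α → α := fun a ↦ (Quotient.mk (Equiv.Perm.SameCycle.setoid σ) a).out
  have hr : ∀ a, σ.SameCycle (r a) a := fun a ↦
    Quotient.exact (s := Equiv.Perm.SameCycle.setoid σ) (Quotient.out_eq _)
  have hr' : ∀ a k, r (σ^[k] a) = r a := by
    intro a k
    have : σ.SameCycle (σ^[k] a) a := by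
      rw [← Equiv.Perm.coe_pow]
      exact (Equiv.Perm.SameCycle.refl σ a).pow_left
    simp only [r]
    congr 1
    exact Quotient.sound (s := Equiv.Perm.SameCycle.setoid σ) this
  have hk : ∀ a, ∃ k, σ^[k] (r a) = a := by
    intro a
    obtain ⟨k, hk⟩ := (hr a).exists_nat_pow_eq
    exact ⟨k, by rw [← Equiv.Perm.coe_pow]; exact hk⟩
  have hmin : ∀ a k, minimalPeriod σ (σ^[k] a) = minimalPeriod σ a := fun a k ↦
    minimalPeriod_apply_iterate (hper a) k
  have hminr : ∀ a, minimalPeriod σ (r a) = minimalPeriod σ a := by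
    intro a
    obtain ⟨k, hk⟩ := hk a
    conv_rhs => rw [← hk, hmin]
  choose k hk using hk
  have hpos : ∀ a, 0 < minimalPeriod σ a := fun a ↦ minimalPeriod_pos_of_mem_periodicPts (hper a)
  have hν : ∀ a, σ^[k a % minimalPeriod σ a] (r a) = a := by
    intro a
    rw [← hminr, iterate_mod_minimalPeriod_eq, hk]
  refine ⟨fun a ↦ k a % minimalPeriod σ a, fun a ↦ Nat.mod_lt _ (hpos a), fun b n hn ↦ ?_⟩
  set l := k b % minimalPeriod σ b with hl
  have hlb : l < minimalPeriod σ b := Nat.mod_lt _ (hpos b)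
  have hrb : σ^[minimalPeriod σ b - l] b = r b := by
    have h := hν b
    rw [← hl] at h
    calc σ^[minimalPeriod σ b - l] b = σ^[minimalPeriod σ b - l] (σ^[l] (r b)) := by rw [h]
      _ = σ^[minimalPeriod σ b] (r b) := by rw [← iterate_add_apply, Nat.sub_add_cancel hlb.le]
      _ = r b := by rw [← hminr, iterate_minimalPeriod]
  -- From `b` forward to the base point, then `n` further steps.
  refine ⟨n + (minimalPeriod σ b - l), ?_⟩
  set a := σ^[n + (minimalPeriod σ b - l)] b with ha
  have ha' : σ^[n] (r b) = a := by rw [ha, iterate_add_apply, hrb]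
  have h1 : σ^[k a % minimalPeriod σ a] (r a) = σ^[n] (r b) := by rw [hν, ha']
  have h2 : r a = r b := hr' b _
  have h3 : minimalPeriod σ a = minimalPeriod σ b := hmin b _
  rw [h2] at h1
  refine iterate_injOn_Iio_minimalPeriod (f := σ) (x := r b) ?_ ?_ h1
  · rw [Set.mem_Iio, hminr, ← h3]
    exact Nat.mod_lt _ (hpos a)
  · rw [Set.mem_Iio, hminr]
    exact hn

/-- The cycles of `γ` on the cosets: `h a` is the length of the cycle of `a`, and `ν` numbers the
elements of each cycle. -/
theorem CosetReps.exists_cycle_data {Γ Δ : Subgroup SL(2, ℝ)} {d : ℕ} (g : CosetReps Γ Δ d)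
    {γ : SL(2, ℝ)} (hγ : γ ∈ Γ) : ∃ h ν : Fin d → ℕ, (∀ a, ν a < h a) ∧
      (∀ a k, (g.rep a)⁻¹ * γ ^ k * g.rep a ∈ Δ ↔ h a ∣ k) ∧
      ∀ b n, n < h b → ∃ a k, ν a = n ∧ h a = h b ∧ (g.rep a)⁻¹ * γ ^ k * g.rep b ∈ Δ := by
  choose s hs using g.exists_target hγ
  have hinj : Injective s := by
    intro b b' hbb
    have h1 := hs b
    rw [hbb] at h1
    have h2 := Δ.mul_mem (Δ.inv_mem h1) (hs b')
    exact g.eq_of_mem (by simpa [mul_assoc] using h2)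
  let σ : Equiv.Perm (Fin d) := Equiv.ofBijective s (Finite.injective_iff_bijective.1 hinj)
  have hit : ∀ k b, (g.rep (σ^[k] b))⁻¹ * γ ^ k * g.rep b ∈ Δ := by
    intro k b
    induction k with
    | zero => simp [Δ.one_mem]
    | succ k ih =>
      have h1 := Δ.mul_mem (hs (σ^[k] b)) ih
      rw [iterate_succ_apply', pow_succ']
      simpa [mul_assoc, σ] using h1
  have hiff : ∀ a k, (g.rep a)⁻¹ * γ ^ k * g.rep a ∈ Δ ↔ minimalPeriod σ a ∣ k := by
    intro a k
    rw [← isPeriodicPt_iff_minimalPeriod_dvd]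
    constructor
    · intro h
      refine (g.eq_of_mem ?_ : σ^[k] a = a)
      have h1 := Δ.mul_mem (hit k a) (Δ.inv_mem h)
      simpa [mul_assoc] using h1
    · intro h
      have h1 := hit k a
      rwa [h] at h1
  obtain ⟨ν, hν1, hν2⟩ := exists_cycle_position σ
  refine ⟨minimalPeriod σ, ν, hν1, hiff, fun b n hn ↦ ?_⟩
  obtain ⟨k, hk⟩ := hν2 b n hn
  exact ⟨σ^[k] b, k, hk, minimalPeriod_apply_iterate (σ.injective.mem_periodicPts b) k, hit k b⟩

end Cycles

/-! ### The lift at a cusp -/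

section LiftAt

open Matrix.SpecialLinearGroup

theorem neg_one_mem_preimageSL (G : Subgroup PSL2R) : -1 ∈ preimageSL G := by
  have h : (-1 : SL(2, ℝ)) ∈ Subgroup.center SL(2, ℝ) := by
    rw [Subgroup.mem_center_iff]
    intro x
    simp
  rw [preimageSL, Subgroup.mem_comap, QuotientGroup.mk'_apply, (QuotientGroup.eq_one_iff _).2 h]
  exact G.one_mem

variable {Γ Δ : Subgroup SL(2, ℝ)} {d m : ℕ}

/-- The generator `A_c t ^ w A_c⁻¹` of the group of translations in `Γ` at the cusp `c`. -/
def cuspGenerator (Γ : Subgroup SL(2, ℝ)) (c : OnePoint ℝ) : SL(2, ℝ) :=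
  scaling c * transl (cuspWidth (conjSubgroup (scaling c)⁻¹ Γ) OnePoint.infty) * (scaling c)⁻¹

theorem cuspGenerator_pow (Γ : Subgroup SL(2, ℝ)) (c : OnePoint ℝ) (n : ℕ) :
    cuspGenerator Γ c ^ n = scaling c *
      transl (n * cuspWidth (conjSubgroup (scaling c)⁻¹ Γ) OnePoint.infty) * (scaling c)⁻¹ := by
  rw [cuspGenerator, conj_pow, transl_nat_mul]

theorem transl_mem_conjElt_iff (g : CosetReps Γ Δ d) (c : OnePoint ℝ) (a : Fin d) (n : ℕ) :
    transl (n * cuspWidth (conjSubgroup (scaling c)⁻¹ Γ) OnePoint.infty) ∈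
      conjSubgroup (conjElt g c a) Δ ↔ (g.rep a)⁻¹ * cuspGenerator Γ c ^ n * g.rep a ∈ Δ := by
  rw [mem_conjSubgroup, cuspGenerator_pow, conjElt]
  simp only [mul_inv_rev, inv_inv, mul_assoc]

theorem transl_mem_of_mem_conjElt (hΔ : Δ ≤ Γ) (g : CosetReps Γ Δ d) (c : OnePoint ℝ) (a : Fin d)
    {x : ℝ} (h : transl x ∈ conjSubgroup (conjElt g c a) Δ) :
    transl x ∈ conjSubgroup (scaling c)⁻¹ Γ := by
  rw [mem_conjSubgroup, conjElt] at h
  rw [mem_conjSubgroup, inv_inv]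
  have h1 := Γ.mul_mem (Γ.mul_mem (g.rep_mem a) (hΔ h)) (Γ.inv_mem (g.rep_mem a))
  simpa [mul_assoc] using h1

theorem transl_cuspWidth_mem [DiscreteTopology Γ] {c : OnePoint ℝ} (hc : IsCusp c (toGL Γ)) :
    transl (cuspWidth (conjSubgroup (scaling c)⁻¹ Γ) OnePoint.infty) ∈
      conjSubgroup (scaling c)⁻¹ Γ :=
  ((cuspWidth_conj_scaling hc).2 _).2 ⟨1, by simp⟩

theorem cuspGenerator_mem [DiscreteTopology Γ] {c : OnePoint ℝ} (hc : IsCusp c (toGL Γ)) :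
    cuspGenerator Γ c ∈ Γ := by
  simpa [cuspGenerator] using mem_conjSubgroup.1 (transl_cuspWidth_mem hc)

/-- If `h` is the length of the cycle of the coset of `g_a` under the stabilizer of the cusp, the
width of the cusp of `s_a Δ s_a⁻¹` is `h` times the width of the cusp of `Γ`. -/
theorem cuspWidth_conjElt [DiscreteTopology Γ] (hΔ : Δ ≤ Γ) (g : CosetReps Γ Δ d)
    {c : OnePoint ℝ} (hc : IsCusp c (toGL Γ)) {a : Fin d} {h : ℕ} (hh : 0 < h)
    (hk : ∀ k, (g.rep a)⁻¹ * cuspGenerator Γ c ^ k * g.rep a ∈ Δ ↔ h ∣ k) :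
    cuspWidth (conjSubgroup (conjElt g c a) Δ) OnePoint.infty =
      h * cuspWidth (conjSubgroup (scaling c)⁻¹ Γ) OnePoint.infty := by
  obtain ⟨hw, hmem⟩ := cuspWidth_conj_scaling hc
  rw [cuspWidth_infty]
  refine IsLeast.csInf_eq ⟨⟨by positivity, ?_⟩, ?_⟩
  · rw [transl_mem_conjElt_iff, hk]
  · rintro x ⟨hx0, hx⟩
    obtain ⟨k, rfl⟩ := (hmem x).1 (transl_mem_of_mem_conjElt hΔ g c a hx)
    have hk0 : (0 : ℤ) < k := by exact_mod_cast (pos_of_mul_pos_left hx0 hw.le : (0 : ℝ) < k)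
    lift k to ℕ using hk0.le
    rw [Int.cast_natCast, transl_mem_conjElt_iff, hk] at hx
    have h1 : (h : ℝ) ≤ k := by exact_mod_cast Nat.le_of_dvd (by exact_mod_cast hk0) hx
    rw [Int.cast_natCast]
    exact mul_le_mul_of_nonneg_right h1 hw.le

theorem monodromy_componentRep (g : CosetReps Γ Δ d) (ρ : Δ →* GL (Fin m) ℂ) {c : OnePoint ℝ}
    {a : Fin d} {h : ℕ} (hw : cuspWidth (conjSubgroup (conjElt g c a) Δ) OnePoint.infty =
      h * cuspWidth (conjSubgroup (scaling c)⁻¹ Γ) OnePoint.infty) :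
    monodromy (componentRep g c ρ a) =
      repMat ρ ((g.rep a)⁻¹ * cuspGenerator Γ c ^ h * g.rep a) := by
  rw [monodromy, componentRep, repMat_conjRep, hw, cuspGenerator_pow, conjElt]
  simp only [mul_inv_rev, inv_inv, mul_assoc]

theorem monodromy_liftAtRep [DiscreteTopology Γ] (g : CosetReps Γ Δ d) (ρ : Δ →* GL (Fin m) ℂ)
    {c : OnePoint ℝ} (hc : IsCusp c (toGL Γ)) :
    monodromy (liftAtRep g c ρ) = inducedMatrix g ρ (cuspGenerator Γ c) := by
  rw [monodromy, liftAtRep, repMat_conjRep, inv_inv,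
    ← repMat_inducedRep g ρ (cuspGenerator_mem hc), cuspGenerator]

theorem eq_zero_of_repMat_mulVec_eq_zero {ρ : Δ →* GL (Fin m) ℂ} {γ : SL(2, ℝ)} (hγ : γ ∈ Δ)
    {v : Fin m → ℂ} (h : (repMat ρ γ).mulVec v = 0) : v = 0 := by
  rw [repMat, dif_pos hγ] at h
  have h1 := congrArg (((ρ ⟨γ, hγ⟩)⁻¹ : GL (Fin m) ℂ) : Matrix (Fin m) (Fin m) ℂ).mulVec h
  rwa [Matrix.mulVec_mulVec, Units.inv_mul, Matrix.one_mulVec, Matrix.mulVec_zero] at h1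

theorem IsWeaklyHolomorphicVVAF.liftAt {g : CosetReps Γ Δ d} {ρ : Δ →* GL (Fin m) ℂ}
    {X : ℍ → Fin m → ℂ}
    (hX : IsWeaklyHolomorphicVVAF 0 Γ (inducedRep g ρ) (VVAF.lift g X)) (c : OnePoint ℝ) :
    IsWeaklyHolomorphicVVAF 0 (conjSubgroup (scaling c)⁻¹ Γ) (liftAtRep g c ρ)
      (VVAF.liftAt g c X) := by
  have := hX.conj (scaling c)⁻¹
  rwa [inv_inv] at this

theorem liftAt_apply (g : CosetReps Γ Δ d) (c : OnePoint ℝ) (X : ℍ → Fin m → ℂ) (τ : ℍ)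
    (a : Fin d) (i : Fin m) : liftAt g c X τ (a, i) = component g c X a τ i := by
  rw [liftAt, component, stroke_zero, stroke_zero, conjElt, mul_inv_rev, inv_inv]
  beta_reduce
  rw [mul_smul]
  rfl

/-- The Fourier coefficients of the lift, in terms of those of its components. -/
theorem liftAt_coeff {g : CosetReps Γ Δ d} {ρ : Δ →* GL (Fin m) ℂ} {X : ℍ → Fin m → ℂ}
    {c : OnePoint ℝ} (hw : 0 < cuspWidth (conjSubgroup (scaling c)⁻¹ Γ) OnePoint.infty)
    (hTL : ∀ κ ∈ eigs (monodromy (liftAtRep g c ρ)), ‖κ‖ = 1) {a : Fin d}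
    (hT : ∀ κ ∈ eigs (monodromy (componentRep g c ρ a)), ‖κ‖ = 1) {h : ℕ} (hh : 0 < h)
    (hwa : cuspWidth (conjSubgroup (conjElt g c a) Δ) OnePoint.infty =
      h * cuspWidth (conjSubgroup (scaling c)⁻¹ Γ) OnePoint.infty)
    {coef : ℂ → ℕ → ℤ → Fin m → ℂ} {coefL : ℂ → ℕ → ℤ → Fin d × Fin m → ℂ}
    (hcoef : IsFourierExpansion (componentRep g c ρ a) (component g c X a) coef)
    (hcoefL : IsFourierExpansion (liftAtRep g c ρ) (liftAt g c X) coefL)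
    (κ : ℂ) (j : ℕ) (n : ℤ) (i : Fin m) :
    coefL κ j n (a, i) =
      (((h : ℚ) ^ j)⁻¹ : ℚ) * coef (κ ^ h) j (h * n + ⌊h * mu κ⌋) i := by
  have h1 := hcoef.hasLogExpansion hT i
  rw [hwa] at h1
  have h2 := hcoefL.hasLogExpansion hTL (a, i)
  simp only [liftAt_apply] at h2
  have h3 := congrFun (congrFun (congrFun (h2.unique hw (h1.regroup hh)) κ) j) n
  rw [h3]
  push_cast
  rfl

/-- Summation over the eigenvalues in the sector given by `ν`, on which `κ ↦ κ ^ h` is injective. -/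
theorem sum_coeff_sector {ι : Type} [Fintype ι] [DecidableEq ι] {α : Type} [Fintype α]
    [DecidableEq α] {TL : Matrix α α ℂ} {T : Matrix ι ι ℂ} {h ν : ℕ} (hν : ν < h)
    (hTL : ∀ κ ∈ eigs TL, ‖κ‖ = 1) (hT : ∀ κ ∈ eigs T, ‖κ‖ = 1) {f F : ℂ → ℂ}
    (hf : ∀ κ, f κ ≠ 0 → κ ∈ eigs T) (hF : ∀ κ, F κ ≠ 0 → κ ∈ eigs TL)
    (hFf : ∀ κ, ⌊h * mu κ⌋ = (ν : ℤ) → F κ = f (κ ^ h)) :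
    ∑ κ ∈ eigs TL, (if ⌊h * mu κ⌋ = (ν : ℤ) then F κ else 0) = ∑ κ ∈ eigs T, f κ := by
  have hh : 0 < h := by omega
  -- Only nonzero terms are matched: `κ ^ h` or the branch of a root is known to be an eigenvalue
  -- just where the coefficient does not vanish, by `hf` and `hF`.
  refine Finset.sum_bij_ne_zero (fun κ _ _ ↦ κ ^ h) (fun κ hκ hne ↦ ?_)
    (fun κ hκ hne κ' hκ' hne' heq ↦ ?_) (fun κ hκ hne ↦ ?_) (fun κ hκ hne ↦ ?_)
  · obtain ⟨h1, h2⟩ := ite_ne_right_iff.1 hne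
    exact hf _ (hFf κ h1 ▸ h2)
  · rw [eq_branch hh (hTL κ hκ) (ite_ne_right_iff.1 hne).1,
      eq_branch hh (hTL κ' hκ') (ite_ne_right_iff.1 hne').1, heq]
  · have h1 : ⌊h * mu (branch h κ ν)⌋ = (ν : ℤ) := floor_mu_branch κ hν
    have h2 : branch h κ ν ^ h = κ := branch_pow hh (hT κ hκ) ν
    have h3 : F (branch h κ ν) = f κ := by rw [hFf _ h1, h2]
    exact ⟨branch h κ ν, hF _ (h3 ▸ hne), by rwa [if_pos h1, h3], h2⟩
  · obtain ⟨h1, h2⟩ := ite_ne_right_iff.1 hne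
    rw [if_pos h1, hFf κ h1]

end LiftAt

end VVAF

end

/-! ### The theorem -/

theorem theorem1p2 (G H : Subgroup VVAF.PSL2R) (hHG : H ≤ G)
    (hG : VVAF.IsFuchsianFirstKind (VVAF.preimageSL G))
    (d m : ℕ) (g : VVAF.CosetReps (VVAF.preimageSL G) (VVAF.preimageSL H) d)
    (ρ : VVAF.preimageSL H →* GL (Fin m) ℂ) (X : ℍ → Fin m → ℂ)
    (hX : VVAF.IsWeaklyHolomorphicVVAF 0 (VVAF.preimageSL H) ρ X)
    (c : OnePoint ℝ) (hc : IsCusp c (VVAF.toGL (VVAF.preimageSL G))) :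
    -- the lift is a form for the induced representation, the `X⁽ᵃ⁾` are forms for the conjugates
    VVAF.IsWeaklyHolomorphicVVAF 0 (VVAF.preimageSL G) (VVAF.inducedRep g ρ) (VVAF.lift g X) ∧
    (∀ a, VVAF.IsWeaklyHolomorphicVVAF 0
      (VVAF.conjSubgroup (VVAF.conjElt g c a) (VVAF.preimageSL H))
      (VVAF.componentRep g c ρ a) (VVAF.component g c X a)) ∧
    -- all of them have Fourier expansions
    (∀ a, ∃ coef, VVAF.IsFourierExpansion (VVAF.componentRep g c ρ a)
      (VVAF.component g c X a) coef) ∧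
    (∃ coef, VVAF.IsFourierExpansion (VVAF.liftAtRep g c ρ) (VVAF.liftAt g c X) coef) ∧
    ∃ (h : Fin d → ℕ) (ν : Fin d → ℕ) (P : GL (Fin d × Fin m) ℂ)
      (R : Fin d → Matrix (Fin m) (Fin m) ℂ),
      -- `h a` is the quotient of the cusp widths, and `0 ≤ ν a < h a`
      (∀ a, 0 < h a ∧ ν a < h a ∧
        VVAF.cuspWidth (VVAF.conjSubgroup (VVAF.conjElt g c a) (VVAF.preimageSL H))
            OnePoint.infty =
          h a * VVAF.cuspWidth (VVAF.conjSubgroup (VVAF.scaling c)⁻¹ (VVAF.preimageSL G))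
            OnePoint.infty) ∧
      -- `P` makes the monodromy of the lift block diagonal, the block `R a` is an `h a`-th root of
      -- the monodromy of `X⁽ᵃ⁾`, with its eigenvalues in the sector that `ν a` determines
      (∀ a, R a ^ h a = VVAF.monodromy (VVAF.componentRep g c ρ a) ∧
        ∀ κ ∈ VVAF.eigs (R a), ⌊h a * VVAF.mu κ⌋ = (ν a : ℤ)) ∧
      ((P⁻¹ : GL (Fin d × Fin m) ℂ) : Matrix (Fin d × Fin m) (Fin d × Fin m) ℂ) *
          VVAF.monodromy (VVAF.liftAtRep g c ρ) * (P : Matrix _ _ ℂ) =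
        Matrix.of (fun x y ↦ if x.1 = y.1 then R x.1 x.2 y.2 else 0) ∧
      ∀ (coef : Fin d → ℂ → ℕ → ℤ → Fin m → ℂ) (coefL : ℂ → ℕ → ℤ → Fin d × Fin m → ℂ),
        (∀ a, VVAF.IsFourierExpansion (VVAF.componentRep g c ρ a)
          (VVAF.component g c X a) (coef a)) →
        VVAF.IsFourierExpansion (VVAF.liftAtRep g c ρ) (VVAF.liftAt g c X) coefL →
        -- the coefficients of each eigenvalue and each power of the logarithm, standard basis
        (∀ κ j n a i, coefL κ j n (a, i) =
          (((h a : ℚ) ^ j)⁻¹ : ℚ) *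
            coef a (κ ^ h a) j (h a * n + ⌊h a * VVAF.mu κ⌋) i) ∧
        -- the same in the basis `P`, where the shift does not depend on the eigenvalue
        (∀ κ j n a i,
          ((P⁻¹ : GL (Fin d × Fin m) ℂ) : Matrix (Fin d × Fin m) (Fin d × Fin m) ℂ).mulVec
            (coefL κ j n) (a, i) =
          if ⌊h a * VVAF.mu κ⌋ = (ν a : ℤ) then
            (((h a : ℚ) ^ j)⁻¹ : ℚ) * coef a (κ ^ h a) j (h a * n + ν a) i
          else 0) ∧
        -- and for the complete `n`-th coefficients
        (∀ n a i,
          ((P⁻¹ : GL (Fin d × Fin m) ℂ) : Matrix (Fin d × Fin m) (Fin d × Fin m) ℂ).mulVec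
            (VVAF.totalCoeff (VVAF.liftAtRep g c ρ) coefL n) (a, i) =
          VVAF.totalCoeff (VVAF.componentRep g c ρ a) (coef a) (h a * n + ν a) i) := by

  have hΔ : VVAF.preimageSL H ≤ VVAF.preimageSL G := Subgroup.comap_mono hHG
  have := hG.discrete
  have hL := hX.lift g (VVAF.neg_one_mem_preimageSL H) (VVAF.neg_one_mem_preimageSL G)
  have hLc := hL.liftAt c
  have hXa : ∀ a, VVAF.IsWeaklyHolomorphicVVAF 0
      (VVAF.conjSubgroup (VVAF.conjElt g c a) (VVAF.preimageSL H))
      (VVAF.componentRep g c ρ a) (VVAF.component g c X a) := fun a ↦ hX.conj _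
  have hγ := VVAF.cuspGenerator_mem hc
  have hw := (VVAF.cuspWidth_conj_scaling hc).1
  have hwmem := VVAF.transl_cuspWidth_mem hc
  obtain ⟨h, ν, hν, hk, hcyc⟩ := g.exists_cycle_data hγ
  have hpos : ∀ a, 0 < h a := fun a ↦ (Nat.zero_le _).trans_lt (hν a)
  have hwidth := fun a ↦ VVAF.cuspWidth_conjElt hΔ g hc (hpos a) (hk a)
  have hwa : ∀ a, 0 < VVAF.cuspWidth
      (VVAF.conjSubgroup (VVAF.conjElt g c a) (VVAF.preimageSL H)) OnePoint.infty := fun a ↦ by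
    rw [hwidth]
    exact mul_pos (by exact_mod_cast hpos a) hw
  have hwamem : ∀ a, VVAF.transl (VVAF.cuspWidth
      (VVAF.conjSubgroup (VVAF.conjElt g c a) (VVAF.preimageSL H)) OnePoint.infty) ∈
      VVAF.conjSubgroup (VVAF.conjElt g c a) (VVAF.preimageSL H) := fun a ↦ by
    rw [hwidth, VVAF.transl_mem_conjElt_iff, hk]
  have hT := fun a ↦ (hXa a).norm_eigs_monodromy (hwa a) (hwamem a)
  have hTL := hLc.norm_eigs_monodromy hw hwmem
  -- Block row `a` of the `h a`-th power of the monodromy has only its diagonal block, since the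
  -- cycle closes there. Between two members of a cycle the block of a suitable power is invertible,
  -- which gives the cyclic condition.
  obtain ⟨P, R, hR, hP, hPv⟩ := VVAF.exists_blockDiagonalization
    (VVAF.monodromy (VVAF.liftAtRep g c ρ)) (fun a ↦ VVAF.monodromy (VVAF.componentRep g c ρ a))
    h ν hν hTL hT (fun a v i ↦ by
      rw [VVAF.monodromy_liftAtRep g ρ hc, VVAF.inducedMatrix_pow g ρ hγ,
        VVAF.monodromy_componentRep g ρ (hwidth a),
        VVAF.inducedMatrix_mulVec g ρ ((hk a _).2 dvd_rfl)]) (fun b n hn ↦ by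
      obtain ⟨a, k, h1, h2, h3⟩ := hcyc b n hn
      refine ⟨a, k, h1, h2, fun v hv i ↦ ?_⟩
      simp only [VVAF.monodromy_liftAtRep g ρ hc, VVAF.inducedMatrix_pow g ρ hγ,
        VVAF.inducedMatrix_mulVec g ρ h3] at hv
      exact congrFun (VVAF.eq_zero_of_repMat_mulVec_eq_zero h3 (funext hv)) i)
  refine ⟨hL, hXa, fun a ↦ (hXa a).exists_isFourierExpansion (hwa a) (hwamem a),
    hLc.exists_isFourierExpansion hw hwmem, h, ν, P, R, fun a ↦ ⟨hpos a, hν a, hwidth a⟩, hR, hP,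
    fun coef coefL hcoef hcoefL ↦ ?_⟩
  have hcoeff := fun κ j n a i ↦ VVAF.liftAt_coeff hw hTL (hT a) (hpos a) (hwidth a) (hcoef a)
    hcoefL κ j n i
  -- The coefficient lies in the generalized eigenspace of `κ`, where `P⁻¹` merely selects blocks by
  -- sector.
  have hcoeffP : ∀ κ j n a i,
      ((P⁻¹ : GL (Fin d × Fin m) ℂ) : Matrix (Fin d × Fin m) (Fin d × Fin m) ℂ).mulVec
        (coefL κ j n) (a, i) =
      if ⌊h a * VVAF.mu κ⌋ = (ν a : ℤ) then coefL κ j n (a, i) else 0 := fun κ j n a i ↦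
    hPv κ _ (hcoefL.mem_maxGenEigenspace_of_form hLc hw hwmem κ j n) a i
  refine ⟨hcoeff, fun κ j n a i ↦ ?_, fun n a i ↦ ?_⟩
  · rw [hcoeffP]
    split_ifs with hκ
    · rw [hcoeff, hκ]
    · rfl
  · rw [VVAF.totalCoeff, VVAF.totalCoeff, Matrix.mulVec_sum, Finset.sum_apply, Finset.sum_apply]
    simp only [hcoeffP]
    refine VVAF.sum_coeff_sector (F := fun κ ↦ coefL κ 0 n (a, i))
      (f := fun κ ↦ coef a κ 0 (h a * n + ν a) i) (hν a) hTL (hT a)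
      (fun κ hκ ↦ ((hcoef a).support κ _ _ fun h0 ↦ hκ (by rw [h0]; rfl)).1)
      (fun κ hκ ↦ (hcoefL.support κ _ _ fun h0 ↦ hκ (by rw [h0]; rfl)).1) fun κ hκ ↦ ?_
    rw [hcoeff, hκ, pow_zero, inv_one, Rat.cast_one, one_mul]
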